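/- Let $\mathcal T$ be a triangulated category with small Hom-sets and small coproducts, with shift $\Sigma$. A t-structure on a triangulated category $\mathcal S$ is denoted $(\mathcal S^{\le 0},\mathcal S^{\ge 1})$, with $\mathcal S^{\le n}=\Sigma^{-n}\mathcal S^{\le 0}$ and $\mathcal S^{\ge n}=\Sigma^{1-n}\mathcal S^{\ge 1}$; two t-structures are equivalent if $\mathcal S_1^{\le -N}\subseteq\mathcal S_2^{\le 0}\subseteq\mathcal S_1^{\le N}$ for some $N>0$. For an object $G$ and integers $m\le n$, possibly infinite, let $G[m,n]$ consist of the objects $\Sigma^iG$ with $m\le -i\le n$. Let $\mathrm{Coprod}(\mathcal A)$ be the smallest full subcategory that contains $\mathcal A$ and is closed under extensions and small coproducts. A compact generator is a compact object $G$ such that $\mathrm{Hom}(G,\Sigma^nX)=0$ for all $n\in\mathbb Z$ only if $X=0$. If $G$ is a compact generator, then $\mathrm{Coprod}(G(-\infty,0])$ is the aisle of a t-structure $\tau_G$ on $\mathcal T$; the preferred equivalence class of t-structures on $\mathcal T$ consists of the t-structures equivalent to $\tau_G$ for some (equivalently, every) compact generator $G$. For $(\mathcal T^{\le 0},\mathcal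 T^{\ge 1})$ in this class put $\mathcal T^-=\bigcup_m\mathcal T^{\le m}$, $\mathcal T^+=\bigcup_m\mathcal T^{\ge -m}$ and $\mathcal T^b=\mathcal T^-\cap\mathcal T^+$ (these do not depend on the choice). For $\mathcal S\in\{\mathcal T^-,\mathcal T^+,\mathcal T^b\}$, the preferred equivalence class on $\mathcal S$ consists of the t-structures on $\mathcal S$ equivalent to the restriction to $\mathcal S$ of a t-structure in the preferred class on $\mathcal T$. $\mathcal T$ is weakly approximable if there are an integer $A>0$, a compact generator $G$ and a t-structure on $\mathcal T$ such that $G\in\mathcal T^{\le A}$, $\mathrm{Hom}(G,\mathcal T^{\le -A})=0$, and every $F\in\mathcal T^{\le 0}$ lies in a distinguished triangle $E\to F\to D\to\Sigma E$ with $D\in\mathcal T^{\le -1}$ and $E$ a direct summand of an object of $\mathrm{Coprod}(G[-A,A])$. For a triangulated category $\mathcal S$, let $\mathcal P(\mathcal S)$ be the class of strictly full subcategories $P\subseteq\mathcal S$ with $\Sigma P\subseteq P$. Call $P,Q\in\mathcal P(\mathcal S)$ equivalent if $\Sigma^AP\subseteq Q\subseteq\Sigma^{-A}P$ for some $A>0$,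 and order the equivalence classes by $[P]\le[Q]$ if $\Sigma^AP\subseteq Q$ for some $A>0$. For $I\in\mathcal S$ put $P(I)={}^\perp I[0,\infty)=\{X\in\mathcal S:\mathrm{Hom}(X,\Sigma^{-m}I)=0\text{ for all }m\ge 0\}$. (1) Suppose that $\mathcal T$ has a compact generator. Then the preferred equivalence class on $\mathcal T$ is non-empty. Put $\mathcal S=\mathcal T^-$. Among the classes $[\mathcal S^{\le 0}]$ of the aisles of the t-structures on $\mathcal S$ that satisfy $\mathcal S=\bigcup_{m\ge 1}\mathcal S^{\le m}$ there is a least one. A t-structure on $\mathcal S$ belongs to the preferred equivalence class if and only if $\mathcal S=\bigcup_{m\ge1}\mathcal S^{\le m}$ and $[\mathcal S^{\le 0}]$ is the unique minimal element among the classes of the aisles of such t-structures. (2) Suppose that $\mathcal T$ is weakly approximable and put $\mathcal S=\mathcal T^+$. Among the classes $[P(I)]$, $I\in\mathcal S$, there is a unique minimal one, and it is the least one. A t-structure on $\mathcal S$ belongs to the preferred equivalence class if and only if $[\mathcal S^{\le 0}]$ is equal to this class. Moreover, every compact generator $G$ of $\mathcal T$ has a Brown–Comenetz dual, that is, an object $I$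 with a natural isomorphism $\mathrm{Hom}(-,I)\cong\mathrm{Hom}_{\mathbb Z}(\mathrm{Hom}(G,-),\mathbb Q/\mathbb Z)$ of functors to abelian groups; every such $I$ lies in $\mathcal T^+$, and $[P(I)]$ is the minimal class. (3) Suppose that $\mathcal T$ is weakly approximable and put $\mathcal S=\mathcal T^b$. Among the classes $[P(I)]$, $I\in\mathcal S$, there is a unique minimal one, and it is the least one. A t-structure on $\mathcal S$ belongs to the preferred equivalence class if and only if $[\mathcal S^{\le 0}]$ is equal to this class. -/

import Mathlib

open CategoryTheory Limits Opposite Pretriangulated Triangulated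

universe v u

namespace TStr

section Basic

variable {C : Type u} [Category.{v} C] [Preadditive C] [HasZeroObject C] [HasShift C ℤ]
  [∀ (n : ℤ), (shiftFunctor C n).Additive] [Pretriangulated C]

/-- The full subcategory of all `Σ^i G` with `-i ∈ s`. With `s` an interval `[m, n]` of integers
(possibly infinite) it is the subcategory `G[m, n]`. -/
def shifts (G : C) (s : Set ℤ) : ObjectProperty C :=
  fun X => ∃ j ∈ s, Nonempty (X ≅ G⟦-j⟧)

/-- `Coprod(A)`: the smallest full subcategory which contains `A` and is closed under extensions
and under small coproducts. -/
inductive Coprod (A : ObjectProperty C) : ObjectProperty C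
  | of_mem (X : C) (hX : A X) : Coprod A X
  | of_triangle (T : Triangle C) (hT : T ∈ distTriang C) (h₁ : Coprod A T.obj₁)
      (h₃ : Coprod A T.obj₃) : Coprod A T.obj₂
  | of_coproduct {ι : Type v} (X : ι → C) (hX : ∀ i, Coprod A (X i)) (c : Cofan X)
      (hc : IsColimit c) : Coprod A c.pt

/-- An object `c` is compact if `Hom(c, -)`, with values in abelian groups, preserves small
coproducts. -/
def IsCompactObject (c : C) : Prop :=
  ∀ ι : Type v, PreservesColimitsOfShape (Discrete ι) (preadditiveCoyoneda.obj (op c))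

/-- A compact generator: a compact object `G` such that `Hom(G, Σ^n X) = 0` for all `n` only
if `X` is zero. -/
def IsCompactGenerator (G : C) : Prop :=
  IsCompactObject G ∧ ∀ X : C, (∀ (n : ℤ) (f : G ⟶ X⟦n⟧), f = 0) → IsZero X

/-- The aisle `Coprod(G(-∞, 0])` of the t-structure generated by `G`. -/
def generatedAisle (G : C) : ObjectProperty C := Coprod (shifts G (Set.Iic 0))

/-- Two t-structures are equivalent if `C₁^{≤ -N} ⊆ C₂^{≤ 0} ⊆ C₁^{≤ N}` for some `N > 0`. -/
def Equivalent (t₁ t₂ : TStructure C) : Prop :=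
  ∃ N : ℤ, 0 < N ∧ t₁.le (-N) ≤ t₂.le 0 ∧ t₂.le 0 ≤ t₁.le N

/-- `t` belongs to the preferred equivalence class of t-structures: it is equivalent to the
t-structure with aisle `Coprod(G(-∞, 0])`, where `G` is a compact generator. -/
def IsPreferred (t : TStructure C) : Prop :=
  ∃ G : C, IsCompactGenerator G ∧
    ∃ N : ℤ, 0 < N ∧ t.le (-N) ≤ generatedAisle G ∧ generatedAisle G ≤ t.le N

/-- A t-structure on a triangulated subcategory `S` belongs to the preferred equivalence class
on `S` if it is equivalent to the restriction to `S` of a t-structure on the ambient category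
in the preferred equivalence class. -/
def IsPreferredOn (S : ObjectProperty C) [S.IsTriangulated]
    (s : TStructure S.FullSubcategory) : Prop :=
  ∃ (t : TStructure C) (_ : S.HasInducedTStructure t),
    IsPreferred t ∧ Equivalent s (S.tStructure t)

/-- Weak approximability (the existence of coproducts is a separate hypothesis). The subcategory
`(Coprod (shifts G (Set.Icc (-A) A))).retractClosure` consists of the direct summands of objects
of `Coprod(G[-A, A])`. -/
def IsWeaklyApproximable (C : Type u) [Category.{v} C] [Preadditive C] [HasZeroObject C]
    [HasShift C ℤ] [∀ (n : ℤ), (shiftFunctor C n).Additive] [Pretriangulated C] : Prop :=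
  ∃ (A : ℤ) (G : C) (t : TStructure C), 0 < A ∧ IsCompactGenerator G ∧
    t.le A G ∧ (∀ (X : C) (f : G ⟶ X), t.le (-A) X → f = 0) ∧
    ∀ F : C, t.le 0 F →
      ∃ (E D : C) (f : E ⟶ F) (g : F ⟶ D) (h : D ⟶ E⟦(1 : ℤ)⟧),
        Triangle.mk f g h ∈ distTriang C ∧
        (Coprod (shifts G (Set.Icc (-A) A))).retractClosure E ∧ t.le (-1) D

/-- `I` is a Brown–Comenetz dual of `G`: it represents the functor
`X ↦ Hom(Hom(G, X), ℚ/ℤ)` to abelian groups. -/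
def IsBrownComenetzDual (G I : C) : Prop :=
  ∃ e : ∀ X : C, (X ⟶ I) ≃+ ((G ⟶ X) →+ AddCircle (1 : ℚ)),
    ∀ ⦃X Y : C⦄ (f : X ⟶ Y) (g : Y ⟶ I) (φ : G ⟶ X), e X (f ≫ g) φ = e Y g (φ ≫ f)

end Basic

section Classes

variable (S : Type u) [Category.{v} S] [HasShift S ℤ]

/-- The (strictly) full subcategories `P` of `S` with `ΣP ⊆ P`. -/
structure ShiftClosed where
  prop : ObjectProperty S
  iso : prop.IsClosedUnderIsomorphisms
  shift : prop ≤ prop.shift (1 : ℤ)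

attribute [instance] ShiftClosed.iso

variable {S}

theorem ShiftClosed.le_shift_nat (P : ShiftClosed S) (n : ℕ) : P.prop ≤ P.prop.shift (n : ℤ) := by
  induction n with
  | zero => simp
  | succ n ih =>
    intro X hX
    have h := P.shift _ (ih X hX)
    rw [← P.prop.shift_shift (n : ℤ) 1 ((n + 1 : ℕ) : ℤ) (by push_cast; rfl)]
    exact h

theorem ShiftClosed.le_shift (P : ShiftClosed S) {n : ℤ} (hn : 0 ≤ n) :
    P.prop ≤ P.prop.shift n := by
  obtain ⟨k, rfl⟩ := Int.eq_ofNat_of_zero_le hn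
  exact P.le_shift_nat k

theorem ShiftClosed.shift_le_iff (P Q : ShiftClosed S) (A : ℤ) :
    P.prop.shift (-A) ≤ Q.prop ↔ P.prop ≤ Q.prop.shift A := by
  constructor
  · intro h X hX
    refine h _ ?_
    change P.prop _
    exact (P.prop.prop_iff_of_iso (shiftShiftNeg X A)).2 hX
  · intro h X hX
    have := h _ hX
    exact (Q.prop.prop_iff_of_iso (shiftNegShift X A)).1 this

theorem ShiftClosed.le_shift_trans {P Q R : ShiftClosed S} {A B : ℤ}
    (h₁ : P.prop ≤ Q.prop.shift A) (h₂ : Q.prop ≤ R.prop.shift B) :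
    P.prop ≤ R.prop.shift (A + B) := by
  intro X hX
  rw [← R.prop.shift_shift A B (A + B) rfl]
  exact h₂ _ (h₁ _ hX)

theorem ShiftClosed.le_shift_mono {P Q : ShiftClosed S} {A B : ℤ} (hAB : A ≤ B)
    (h : P.prop ≤ Q.prop.shift A) : P.prop ≤ Q.prop.shift B := by
  have := ShiftClosed.le_shift_trans h (Q.le_shift (sub_nonneg.2 hAB))
  simpa using this

/-- `P` and `Q` are equivalent if `Σ^A P ⊆ Q ⊆ Σ^{-A} P` for some `A > 0`. Note that
`P.shift a` is the property `X⟦a⟧ ∈ P`, that is, the subcategory `Σ^{-a} P`. -/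
instance ShiftClosed.setoid : Setoid (ShiftClosed S) where
  r P Q := ∃ A : ℤ, 0 < A ∧ P.prop.shift (-A) ≤ Q.prop ∧ Q.prop ≤ P.prop.shift A
  iseqv :=
    { refl := fun P =>
        ⟨1, one_pos, (P.shift_le_iff P 1).2 P.shift, P.shift⟩
      symm := fun {P Q} ⟨A, hA, h₁, h₂⟩ =>
        ⟨A, hA, (Q.shift_le_iff P A).2 h₂, (P.shift_le_iff Q A).1 h₁⟩
      trans := fun {P Q R} ⟨A, hA, h₁, h₂⟩ ⟨B, hB, h₃, h₄⟩ =>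
        ⟨A + B, add_pos hA hB,
          (P.shift_le_iff R _).2 (ShiftClosed.le_shift_trans
            ((P.shift_le_iff Q A).1 h₁) ((Q.shift_le_iff R B).1 h₃)),
          by rw [add_comm A B]; exact ShiftClosed.le_shift_trans h₄ h₂⟩ }

variable (S) in
/-- The equivalence classes of full subcategories `P` with `ΣP ⊆ P`. -/
abbrev ShiftClass : Type u := Quotient (ShiftClosed.setoid (S := S))

/-- `[P] ≤ [Q]` if, for a choice of representatives, `Σ^A P ⊆ Q` for some `A > 0`. -/
instance : LE (ShiftClass S) where
  le a b := ∃ P Q : ShiftClosed S, a = ⟦P⟧ ∧ b = ⟦Q⟧ ∧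
    ∃ A : ℤ, 0 < A ∧ P.prop.shift (-A) ≤ Q.prop

theorem ShiftClass.mk_le_mk_iff (P Q : ShiftClosed S) :
    (⟦P⟧ : ShiftClass S) ≤ ⟦Q⟧ ↔ ∃ A : ℤ, 0 < A ∧ P.prop ≤ Q.prop.shift A := by
  constructor
  · rintro ⟨P', Q', hP, hQ, A, hA, h⟩
    obtain ⟨B, hB, _, h₁⟩ := Quotient.exact hP.symm
    obtain ⟨D, hD, h₂, _⟩ := Quotient.exact hQ.symm
    exact ⟨B + A + D, by positivity, ShiftClosed.le_shift_trans
      (ShiftClosed.le_shift_trans h₁ ((P'.shift_le_iff Q' A).1 h)) ((Q'.shift_le_iff Q D).1 h₂)⟩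
  · rintro ⟨A, hA, h⟩
    exact ⟨P, Q, rfl, rfl, A, hA, (P.shift_le_iff Q A).2 h⟩

instance : PartialOrder (ShiftClass S) where
  le_refl a := by
    induction a using Quotient.inductionOn with
    | h P => exact (ShiftClass.mk_le_mk_iff P P).2 ⟨1, one_pos, P.shift⟩
  le_trans a b c := by
    induction a using Quotient.inductionOn with
    | h P =>
    induction b using Quotient.inductionOn with
    | h Q =>
    induction c using Quotient.inductionOn with
    | h R =>
    simp only [ShiftClass.mk_le_mk_iff]
    rintro ⟨A, hA, h₁⟩ ⟨B, hB, h₂⟩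
    exact ⟨A + B, add_pos hA hB, ShiftClosed.le_shift_trans h₁ h₂⟩
  le_antisymm a b := by
    induction a using Quotient.inductionOn with
    | h P =>
    induction b using Quotient.inductionOn with
    | h Q =>
    simp only [ShiftClass.mk_le_mk_iff]
    rintro ⟨A, hA, h₁⟩ ⟨B, hB, h₂⟩
    exact Quotient.sound ⟨A + B, add_pos hA hB,
      (P.shift_le_iff Q _).2 (ShiftClosed.le_shift_mono (by linarith) h₁),
      ShiftClosed.le_shift_mono (by linarith) h₂⟩

/-- `a` is the unique minimal element of the set `A` of a partially ordered set. -/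
def IsUniqueMinimal {α : Type*} [LE α] (A : Set α) (a : α) : Prop :=
  Minimal (· ∈ A) a ∧ ∀ b, Minimal (· ∈ A) b → b = a

end Classes

section Aisles

variable {S : Type u} [Category.{v} S] [Preadditive S] [HasZeroObject S] [HasShift S ℤ]
  [∀ (n : ℤ), (shiftFunctor S n).Additive] [Pretriangulated S]

/-- The aisle `S^{≤ 0}` of a t-structure. -/
def aisle (s : TStructure S) : ShiftClosed S where
  prop := s.le 0
  iso := inferInstance
  shift := fun X hX => s.le_monotone (by norm_num : (-1 : ℤ) ≤ 0) _
    (s.le_shift 0 1 (-1) (by norm_num) X hX)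

/-- The class `[S^{≤ 0}]`. -/
def aisleClass (s : TStructure S) : ShiftClass S := ⟦aisle s⟧

/-- The condition that `S` is the union of the `S^{≤ m}`, `m ≥ 1`. -/
def IsUnionLE (s : TStructure S) : Prop := ∀ X : S, ∃ m : ℤ, 1 ≤ m ∧ s.le m X

/-- The subcategory `P(I) = ⊥(I[0, ∞))` of `S`. -/
def perp (I : S) : ShiftClosed S where
  prop := (shifts I (Set.Ici 0)).leftOrthogonal
  iso := inferInstance
  shift := by
    intro X hX Y f hY
    obtain ⟨j, hj, ⟨e⟩⟩ := hY
    have hj' : (0 : ℤ) ≤ j := hj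
    have h : shifts I (Set.Ici 0) (Y⟦(-1 : ℤ)⟧) :=
      ⟨j + 1, by simp only [Set.mem_Ici]; linarith,
        ⟨(shiftFunctor S (-1 : ℤ)).mapIso e ≪≫
          (shiftFunctorAdd' S (-j) (-1) (-(j + 1)) (by ring)).symm.app I⟩⟩
    have h0 : (shiftShiftNeg X (1 : ℤ)).inv ≫ f⟦(-1 : ℤ)⟧' = 0 := hX _ h
    have h1 : f⟦(-1 : ℤ)⟧' = 0 := by
      rw [← cancel_epi (shiftShiftNeg X (1 : ℤ)).inv, h0, comp_zero]
    exact (shiftFunctor S (-1 : ℤ)).map_injective (by rw [h1, Functor.map_zero])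

/-- The class `[P(I)]`. -/
def perpClass (I : S) : ShiftClass S := ⟦perp I⟧

end Aisles

end TStr

open TStr

/-! One construction supplies the existence statements. Given a cohomological functor `H` and a
compact generator `G`, attach shifts of `G` to realise elements of `H` and to kill relations, and
pass to a homotopy colimit (`CohFunctor.exists_approximation`). For a representable `H` and the
shifts indexed by `Set.Iic 0` this yields the truncation triangles of τ_G. With all shifts allowed
it shows that 𝒯 is generated by the shifts of `G` under extensions and coproducts, and it gives
Brown representability; as ℚ/ℤ is injective, `G` then has a Brown–Comenetz dual.

In all three cases the class of the restricted preferred aisle turns out to be a least element, and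
a least element is the only minimal one. Preferred t-structures are exactly those with this class
(`isPreferredOn_iff`), because a compact object is a summand of an object built from boundedly many
shifts of any compact generator, so all preferred aisles lie within bounded shifts of each other.

On 𝒯⁻, an aisle whose shifts exhaust the category has some shift containing `G`; the matching
coaisle is orthogonal to everything built from `G`(-∞, 0], hence to a shift of the preferred aisle.

On 𝒯⁺ and 𝒯ᵇ, orthogonality puts the preferred aisle below every P(I), since I is bounded below. For
equality, take I dual to `G`: X lies in P(I) iff Hom(G, ΣʲX) = 0 for all j ≥ 0, and weak
approximability turns this vanishing into an upper bound on X
(`WeakApproximation.le_of_hom_eq_zero`). In 𝒯ᵇ the dual itself may be missing, so a truncation of it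
is used, with a descending induction that starts from the fact that X is bounded above
(`WeakApproximation.le_of_hom_truncLE_eq_zero`). -/

namespace TStr

/-! ### Compactness as finite factorization of maps to coproducts -/

section Compact

variable {C : Type u} [Category.{v} C] [Preadditive C] [HasCoproducts.{v} C]

open scoped Classical in
/-- The projection from a coproduct to one of its terms. -/
noncomputable def coprodProj {ι : Type v} (X : ι → C) (i : ι) : ∐ X ⟶ X i := Sigma.π X i

lemma ι_coprodProj_self {ι : Type v} (X : ι → C) (i : ι) :
    Sigma.ι X i ≫ coprodProj X i = 𝟙 _ := by
  classical exact Sigma.ι_π_eq_id X i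

lemma ι_coprodProj_of_ne {ι : Type v} (X : ι → C) {i j : ι} (h : i ≠ j) :
    Sigma.ι X i ≫ coprodProj X j = 0 := by
  classical exact Sigma.ι_π_of_ne X h

/-- The endomorphism of a coproduct which is the projection to a finite subcoproduct. -/
noncomputable def finProj {ι : Type v} (X : ι → C) (s : Finset ι) : ∐ X ⟶ ∐ X :=
  ∑ i ∈ s, coprodProj X i ≫ Sigma.ι X i

lemma ι_finProj_of_mem {ι : Type v} (X : ι → C) (s : Finset ι) {i : ι} (hi : i ∈ s) :
    Sigma.ι X i ≫ finProj X s = Sigma.ι X i := by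
  rw [finProj, Preadditive.comp_sum, Finset.sum_eq_single i]
  · rw [← Category.assoc, ι_coprodProj_self, Category.id_comp]
  · intro j _ hj
    rw [← Category.assoc, ι_coprodProj_of_ne _ hj.symm, zero_comp]
  · exact fun h => (h hi).elim

lemma ι_finProj_of_notMem {ι : Type v} (X : ι → C) (s : Finset ι) {i : ι} (hi : i ∉ s) :
    Sigma.ι X i ≫ finProj X s = 0 := by
  rw [finProj, Preadditive.comp_sum, Finset.sum_eq_zero]
  intro j hj
  rw [← Category.assoc, ι_coprodProj_of_ne _ (by rintro rfl; exact hi hj), zero_comp]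

lemma finProj_comp_of_subset {ι : Type v} (X : ι → C) {s s' : Finset ι} (h : s ⊆ s') :
    finProj X s ≫ finProj X s' = finProj X s := by
  refine Sigma.hom_ext _ _ fun i => ?_
  by_cases hi : i ∈ s
  · rw [← Category.assoc, ι_finProj_of_mem X s hi, ι_finProj_of_mem X s' (h hi)]
  · rw [← Category.assoc, ι_finProj_of_notMem X s hi, zero_comp]

/-- Every map from `c` to a small coproduct factors through a finite subcoproduct. -/
def MapsFactorFinitely (c : C) : Prop :=
  ∀ ⦃ι : Type v⦄ (X : ι → C) (f : c ⟶ ∐ X), ∃ s : Finset ι, f ≫ finProj X s = f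

lemma comp_finProj_of_subset {ι : Type v} {X : ι → C} {c : C} {f : c ⟶ ∐ X} {s s' : Finset ι}
    (hf : f ≫ finProj X s = f) (h : s ⊆ s') : f ≫ finProj X s' = f := by
  rw [← hf, Category.assoc, finProj_comp_of_subset X h]

lemma addMonoidHom_ext_of_isCompactObject {c : C} (hc : IsCompactObject c) {ι : Type v}
    (X : ι → C) {B : Type v} [AddCommGroup B] {φ ψ : (c ⟶ ∐ X) →+ B}
    (h : ∀ (i : ι) (g : c ⟶ X i), φ (g ≫ Sigma.ι X i) = ψ (g ≫ Sigma.ι X i)) : φ = ψ := by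
  have := hc ι
  have hl := isColimitOfHasCoproductOfPreservesColimit (preadditiveCoyoneda.obj (op c)) X
  have key : (AddCommGrpCat.ofHom φ :
      (preadditiveCoyoneda.obj (op c)).obj (∐ X) ⟶ AddCommGrpCat.of B) = AddCommGrpCat.ofHom ψ := by
    refine Cofan.IsColimit.hom_ext hl _ _ fun i => ?_
    ext g
    exact h i g
  ext g
  exact congrArg (fun (q : (preadditiveCoyoneda.obj (op c)).obj (∐ X) ⟶ AddCommGrpCat.of B) =>
    q.hom g) key

/-- The maps that factor finitely form a subgroup containing every map that factors through a single
term. By compactness a homomorphism out of Hom(c, ∐ X) is determined on such maps, so the quotient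
map by this subgroup is zero. -/
lemma IsCompactObject.mapsFactorFinitely {c : C} (hc : IsCompactObject c) :
    MapsFactorFinitely c := by
  classical
  intro ι X
  let A : AddSubgroup (c ⟶ ∐ X) :=
    { carrier := {f | ∃ s : Finset ι, f ≫ finProj X s = f}
      zero_mem' := ⟨∅, zero_comp⟩
      add_mem' := by
        rintro f g ⟨s, hs⟩ ⟨s', hs'⟩
        exact ⟨s ∪ s', by rw [Preadditive.add_comp,
          comp_finProj_of_subset hs Finset.subset_union_left,
          comp_finProj_of_subset hs' Finset.subset_union_right]⟩
      neg_mem' := by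
        rintro f ⟨s, hs⟩
        exact ⟨s, by rw [Preadditive.neg_comp, hs]⟩ }
  have h : QuotientAddGroup.mk' A = 0 := by
    refine addMonoidHom_ext_of_isCompactObject hc X fun i g => ?_
    refine (QuotientAddGroup.eq_zero_iff _).2 ⟨{i}, ?_⟩
    rw [Category.assoc, ι_finProj_of_mem X _ (Finset.mem_singleton_self i)]
  intro f
  exact (QuotientAddGroup.eq_zero_iff f).1 (DFunLike.congr_fun h f)

lemma MapsFactorFinitely.of_isZero {c : C} (hc : IsZero c) : MapsFactorFinitely c :=
  fun _ _ _ => ⟨∅, hc.eq_of_src _ _⟩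

variable [HasShift C ℤ] [∀ (n : ℤ), (shiftFunctor C n).Additive]

/-- The shift of a coproduct is a coproduct. -/
noncomputable def isColimitShiftCofan {ι : Type v} {X : ι → C} {P : C} (g : ∀ i, X i ⟶ P)
    (h : IsColimit (Cofan.mk P g)) (n : ℤ) :
    IsColimit (Cofan.mk (P⟦n⟧) fun i => (g i)⟦n⟧') :=
  isColimitCofanMkObjOfIsColimit (shiftFunctor C n) X g h

lemma MapsFactorFinitely.shift {c : C} (hc : MapsFactorFinitely c) (n : ℤ) :
    MapsFactorFinitely (c⟦n⟧) := by
  intro ι X f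
  let e : ∐ (fun i => (X i)⟦-n⟧) ≅ (∐ X)⟦-n⟧ :=
    (PreservesCoproduct.iso (shiftFunctor C (-n)) X).symm
  have he : ∀ i, Sigma.ι (fun i => (X i)⟦-n⟧) i ≫ e.hom = (Sigma.ι X i)⟦-n⟧' := fun i => by
    simp [e]
  obtain ⟨s, hs⟩ := hc _ ((shiftShiftNeg c n).inv ≫ f⟦-n⟧' ≫ e.inv)
  have h1 : finProj (fun i => (X i)⟦-n⟧) s ≫ e.hom = e.hom ≫ (finProj X s)⟦-n⟧' := by
    refine Sigma.hom_ext _ _ fun i => ?_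
    rw [← Category.assoc, ← Category.assoc, he, ← Functor.map_comp]
    by_cases hi : i ∈ s
    · rw [ι_finProj_of_mem _ _ hi, ι_finProj_of_mem _ _ hi, he]
    · rw [ι_finProj_of_notMem _ _ hi, ι_finProj_of_notMem _ _ hi, zero_comp, Functor.map_zero]
  refine ⟨s, (shiftFunctor C (-n)).map_injective ?_⟩
  rw [← cancel_epi (shiftShiftNeg c n).inv, ← cancel_mono e.inv, Functor.map_comp]
  simp only [Category.assoc] at hs ⊢
  rw [← hs]
  congr 2
  rw [← cancel_mono e.hom]
  simp [h1]

variable [HasZeroObject C] [Pretriangulated C]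

/-- Subtracting a finite projection makes the map vanish on the first vertex, so the difference
comes from the third vertex and is itself captured by a finite set. The union of the two finite sets
captures the original map. -/
lemma MapsFactorFinitely.of_triangle {T : Triangle C} (hT : T ∈ distTriang C)
    (h₁ : MapsFactorFinitely T.obj₁) (h₃ : MapsFactorFinitely T.obj₃) :
    MapsFactorFinitely T.obj₂ := by
  classical
  intro ι X f
  obtain ⟨s, hs⟩ := h₁ X (T.mor₁ ≫ f)
  obtain ⟨g, hg⟩ := T.yoneda_exact₂ hT (f - f ≫ finProj X s) (by
    rw [Preadditive.comp_sub, ← Category.assoc, hs, sub_self])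
  obtain ⟨s', hs'⟩ := h₃ X g
  have h := comp_finProj_of_subset hs' (Finset.subset_union_right (s₁ := s))
  refine ⟨s ∪ s', ?_⟩
  have h2 : (f - f ≫ finProj X s) ≫ finProj X (s ∪ s') = f - f ≫ finProj X s := by
    rw [hg, Category.assoc, h]
  rw [Preadditive.sub_comp, Category.assoc, finProj_comp_of_subset X Finset.subset_union_left,
    sub_left_inj] at h2
  exact h2

end Compact

/-! ### Sequences and homotopy colimits -/

section Sequence

variable {C : Type u} [Category.{v} C]

/-- The transition maps of a sequence. -/
def transition (E : ℕ → C) (s : ∀ n, E n ⟶ E (n + 1)) (n : ℕ) : ∀ k : ℕ, E n ⟶ E (n + k)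
  | 0 => 𝟙 _
  | k + 1 => transition E s n k ≫ s (n + k)

lemma transition_comp (E : ℕ → C) (s : ∀ n, E n ⟶ E (n + 1)) {Z : C} (ι : ∀ n, E n ⟶ Z)
    (hι : ∀ n, s n ≫ ι (n + 1) = ι n) (n k : ℕ) : transition E s n k ≫ ι (n + k) = ι n := by
  induction k with
  | zero => exact Category.id_comp _
  | succ k ih =>
    rw [transition, Category.assoc]
    exact (congrArg _ (hι (n + k))).trans ih

lemma exists_factor_of_le (E : ℕ → C) (s : ∀ n, E n ⟶ E (n + 1)) {Z : C} (ι : ∀ n, E n ⟶ Z)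
    (hι : ∀ n, s n ≫ ι (n + 1) = ι n) {n m : ℕ} (h : n ≤ m) : ∃ q : E n ⟶ E m, q ≫ ι m = ι n := by
  obtain ⟨k, rfl⟩ := Nat.exists_eq_add_of_le h
  exact ⟨_, transition_comp E s ι hι n k⟩

lemma exists_factor_of_sum [Preadditive C] (E : ℕ → C) (s : ∀ n, E n ⟶ E (n + 1)) {Z : C}
    (ι : ∀ n, E n ⟶ Z)
    (hι : ∀ n, s n ≫ ι (n + 1) = ι n) {c : C} (t : Finset (ULift.{v} ℕ))
    (g : ∀ i : ULift.{v} ℕ, c ⟶ E i.down) :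
    ∃ (n : ℕ) (f : c ⟶ E n), f ≫ ι n = ∑ i ∈ t, g i ≫ ι i.down := by
  classical
  induction t using Finset.induction_on with
  | empty => exact ⟨0, 0, by simp⟩
  | insert i t hi ih =>
    obtain ⟨n, f, hf⟩ := ih
    obtain ⟨q, hq⟩ := exists_factor_of_le E s ι hι (le_max_left n i.down)
    obtain ⟨q', hq'⟩ := exists_factor_of_le E s ι hι (le_max_right n i.down)
    refine ⟨max n i.down, f ≫ q + g i ≫ q', ?_⟩
    rw [Preadditive.add_comp, Category.assoc, hq, Category.assoc, hq', hf,
      Finset.sum_insert hi, add_comm]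

end Sequence

section Telescope

variable {C : Type u} [Category.{v} C] [Preadditive C] [HasCoproducts.{v} C]

/-- The map `1 - shift` on the coproduct of a sequence. -/
noncomputable def oneSubShift (E : ℕ → C) (s : ∀ n, E n ⟶ E (n + 1)) :
    ∐ (fun n : ULift.{v} ℕ => E n.down) ⟶ ∐ (fun n : ULift.{v} ℕ => E n.down) :=
  Sigma.desc fun n => Sigma.ι (fun n : ULift.{v} ℕ => E n.down) n -
    s n.down ≫ Sigma.ι (fun n : ULift.{v} ℕ => E n.down) ⟨n.down + 1⟩

lemma ι_oneSubShift (E : ℕ → C) (s : ∀ n, E n ⟶ E (n + 1)) (n : ℕ) :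
    Sigma.ι (fun n : ULift.{v} ℕ => E n.down) ⟨n⟩ ≫ oneSubShift E s =
      Sigma.ι (fun n : ULift.{v} ℕ => E n.down) ⟨n⟩ -
        s n ≫ Sigma.ι (fun n : ULift.{v} ℕ => E n.down) ⟨n + 1⟩ := by
  simp [oneSubShift]

lemma oneSubShift_π_zero (E : ℕ → C) (s : ∀ n, E n ⟶ E (n + 1)) :
    oneSubShift E s ≫ coprodProj (fun n : ULift.{v} ℕ => E n.down) ⟨0⟩ =
      coprodProj (fun n : ULift.{v} ℕ => E n.down) ⟨0⟩ := by
  refine Sigma.hom_ext _ _ ?_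
  rintro ⟨n⟩
  rw [← Category.assoc, ι_oneSubShift, Preadditive.sub_comp, Category.assoc,
    ι_coprodProj_of_ne (fun n : ULift.{v} ℕ => E n.down) (i := ⟨n + 1⟩) (j := ⟨0⟩) (by simp),
    comp_zero, sub_zero]

lemma oneSubShift_π_succ (E : ℕ → C) (s : ∀ n, E n ⟶ E (n + 1)) (m : ℕ) :
    oneSubShift E s ≫ coprodProj (fun n : ULift.{v} ℕ => E n.down) ⟨m + 1⟩ =
      coprodProj (fun n : ULift.{v} ℕ => E n.down) ⟨m + 1⟩ -
        coprodProj (fun n : ULift.{v} ℕ => E n.down) ⟨m⟩ ≫ s m := by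
  refine Sigma.hom_ext _ _ ?_
  rintro ⟨n⟩
  rw [← Category.assoc, ι_oneSubShift, Preadditive.sub_comp, Category.assoc,
    Preadditive.comp_sub, ← Category.assoc _ _ (s m)]
  congr 1
  by_cases h : n = m
  · subst h
    rw [ι_coprodProj_self, ι_coprodProj_self, Category.id_comp, Category.comp_id]
  · rw [ι_coprodProj_of_ne (fun n : ULift.{v} ℕ => E n.down) (i := ⟨n + 1⟩) (j := ⟨m + 1⟩)
        (by simpa using h),
      ι_coprodProj_of_ne (fun n : ULift.{v} ℕ => E n.down) (i := ⟨n⟩) (j := ⟨m⟩)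
        (by simpa using h), comp_zero, zero_comp]

/-- The hypothesis makes component 0 vanish and lets each component force the next one to vanish.
Finite factorization is what allows a map to the coproduct to be recovered from its components. -/
lemma eq_zero_of_comp_oneSubShift (E : ℕ → C) (s : ∀ n, E n ⟶ E (n + 1)) {c : C}
    (hc : MapsFactorFinitely c) (g : c ⟶ ∐ (fun n : ULift.{v} ℕ => E n.down))
    (hg : g ≫ oneSubShift E s = 0) : g = 0 := by
  have h : ∀ m : ℕ, g ≫ coprodProj (fun n : ULift.{v} ℕ => E n.down) ⟨m⟩ = 0 := by
    intro m
    induction m with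
    | zero => rw [← oneSubShift_π_zero E s, ← Category.assoc, hg, zero_comp]
    | succ m ih =>
      have h1 := hg =≫ coprodProj (fun n : ULift.{v} ℕ => E n.down) ⟨m + 1⟩
      rwa [Category.assoc, oneSubShift_π_succ, Preadditive.comp_sub, ← Category.assoc _ _ (s m),
        ih, zero_comp, zero_comp, sub_zero] at h1
  obtain ⟨t, ht⟩ := hc _ g
  rw [← ht, finProj, Preadditive.comp_sum, Finset.sum_eq_zero]
  rintro ⟨m⟩ _
  rw [← Category.assoc, h, zero_comp]

variable [HasShift C ℤ] [∀ (n : ℤ), (shiftFunctor C n).Additive]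
  [HasZeroObject C] [Pretriangulated C]

/-- A homotopy colimit of a sequence: the cone of `1 - shift`. -/
structure Telescope (E : ℕ → C) (s : ∀ n, E n ⟶ E (n + 1)) where
  pt : C
  π : ∐ (fun n : ULift.{v} ℕ => E n.down) ⟶ pt
  δ : pt ⟶ (∐ (fun n : ULift.{v} ℕ => E n.down))⟦(1 : ℤ)⟧
  dist : Triangle.mk (oneSubShift E s) π δ ∈ distTriang C

namespace Telescope

lemma nonempty (E : ℕ → C) (s : ∀ n, E n ⟶ E (n + 1)) : Nonempty (Telescope E s) := by
  obtain ⟨Z, p, d, h⟩ := distinguished_cocone_triangle (oneSubShift E s)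
  exact ⟨⟨Z, p, d, h⟩⟩

variable {E : ℕ → C} {s : ∀ n, E n ⟶ E (n + 1)} (Z : Telescope E s)

/-- The map from the `n`-th object of a sequence to its homotopy colimit. -/
noncomputable def ι (n : ℕ) : E n ⟶ Z.pt := Sigma.ι (fun n : ULift.{v} ℕ => E n.down) ⟨n⟩ ≫ Z.π

lemma comp_ι (n : ℕ) : s n ≫ Z.ι (n + 1) = Z.ι n := by
  have h : oneSubShift E s ≫ Z.π = 0 := comp_distTriang_mor_zero₁₂ _ Z.dist
  have h' := Sigma.ι (fun n : ULift.{v} ℕ => E n.down) ⟨n⟩ ≫= h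
  rw [← Category.assoc, ι_oneSubShift, Preadditive.sub_comp, comp_zero, sub_eq_zero,
    Category.assoc] at h'
  exact h'.symm

/-- The composite with the connecting map is killed by the suspension of `1 - shift`, which is
injective on maps from such a source. So `f` lifts to the coproduct, where it is a finite sum of
maps to terms, and these can be pushed to a common stage. -/
lemma exists_factor {c : C} (hc : MapsFactorFinitely c) (f : c ⟶ Z.pt) :
    ∃ (n : ℕ) (g : c ⟶ E n), f = g ≫ Z.ι n := by
  have h0 : f ≫ Z.δ = 0 := by
    have h2 : (f ≫ Z.δ) ≫ (oneSubShift E s)⟦(1 : ℤ)⟧' = 0 := by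
      have : Z.δ ≫ (oneSubShift E s)⟦(1 : ℤ)⟧' = 0 := comp_distTriang_mor_zero₃₁ _ Z.dist
      rw [Category.assoc, this, comp_zero]
    apply (shiftFunctor C (-1 : ℤ)).map_injective
    rw [Functor.map_zero, ← cancel_mono (shiftShiftNeg _ (1 : ℤ)).hom, zero_comp]
    refine eq_zero_of_comp_oneSubShift E s (hc.shift (-1)) _ ?_
    have h3 := congrArg
      (fun q => (shiftFunctor C (-1 : ℤ)).map q ≫ (shiftShiftNeg _ (1 : ℤ)).hom) h2
    simp only [Functor.map_zero, zero_comp, Functor.map_comp, Category.assoc] at h3 ⊢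
    rw [← h3]
    congr 2
    exact ((shiftFunctorCompIsoId C (1 : ℤ) (-1) (by simp)).hom.naturality _).symm
  obtain ⟨g, hg⟩ : ∃ g : c ⟶ ∐ (fun n : ULift.{v} ℕ => E n.down), f = g ≫ Z.π :=
    Triangle.coyoneda_exact₃ _ Z.dist f h0
  obtain ⟨t, ht⟩ := hc _ g
  obtain ⟨n, f', hf'⟩ := exists_factor_of_sum E s Z.ι Z.comp_ι t
    (fun i => g ≫ coprodProj (fun n : ULift.{v} ℕ => E n.down) i)
  refine ⟨n, f', ?_⟩
  rw [hf', hg]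
  nth_rw 1 [← ht]
  rw [finProj, Preadditive.comp_sum, Preadditive.sum_comp]
  refine Finset.sum_congr rfl fun i _ => ?_
  simp only [Category.assoc, Telescope.ι]

end Telescope

end Telescope

end TStr

namespace TStr

/-! ### Shifts of an object and closure properties of `Coprod` -/

section Shifts

variable {C : Type u} [Category.{v} C] [HasShift C ℤ]

/-- `Σ^n Σ^{-j} G` as a shift of `G`. -/
noncomputable def shiftShiftIso (G : C) (j n k : ℤ) (h : j = k + n) : G⟦-j⟧⟦n⟧ ≅ G⟦-k⟧ :=
  (shiftFunctorAdd' C (-j) n (-k) (by lia)).symm.app G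

lemma shifts_of_mem (G : C) {s : Set ℤ} {j : ℤ} (hj : j ∈ s) : shifts G s (G⟦-j⟧) :=
  ⟨j, hj, ⟨Iso.refl _⟩⟩

lemma shifts_shift {G : C} {s s' : Set ℤ} (n : ℤ) (h : ∀ j ∈ s, j - n ∈ s') {X : C}
    (hX : shifts G s X) : shifts G s' (X⟦n⟧) := by
  obtain ⟨j, hj, ⟨e⟩⟩ := hX
  exact ⟨j - n, h j hj,
    ⟨(shiftFunctor C n).mapIso e ≪≫ shiftShiftIso G j n (j - n) (by lia)⟩⟩

lemma shifts_mono (G : C) {s s' : Set ℤ} (h : s ⊆ s') : shifts G s ≤ shifts G s' :=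
  fun _ ⟨j, hj, e⟩ => ⟨j, h hj, e⟩

lemma shifts_hom_eq_zero [Preadditive C] {G : C} {s : Set ℤ} {Y : C}
    (h : ∀ j ∈ s, ∀ f : G⟦-j⟧ ⟶ Y, f = 0)
    (X : C) (hX : shifts G s X) (f : X ⟶ Y) : f = 0 := by
  obtain ⟨j, hj, ⟨e⟩⟩ := hX
  rw [← cancel_epi e.inv, h j hj (e.inv ≫ f), comp_zero]

end Shifts

section Coprod

variable {C : Type u} [Category.{v} C] [Preadditive C] [HasZeroObject C] [HasShift C ℤ]
  [∀ (n : ℤ), (shiftFunctor C n).Additive] [Pretriangulated C]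

lemma Coprod.of_isZero (A : ObjectProperty C) {X : C} (hX : IsZero X) : Coprod A X :=
  .of_coproduct (ι := PEmpty) (fun i => i.elim) (fun i => i.elim)
    (Cofan.mk X fun i => i.elim)
    (Cofan.IsColimit.mk _ (fun _ => hX.to_ _) (fun _ i => i.elim) (fun _ _ _ => hX.eq_of_src _ _))

/-- Any object isomorphic to `X` is the apex of a colimit cofan on the one-term family `X`. -/
lemma Coprod.of_iso {A : ObjectProperty C} {X Y : C} (e : X ≅ Y) (hX : Coprod A X) :
    Coprod A Y :=
  .of_coproduct (ι := PUnit) (fun _ => X) (fun _ => hX) (Cofan.mk Y fun _ => e.hom)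
    (Cofan.IsColimit.mk _ (fun s => e.inv ≫ s.inj ⟨⟩) (fun s i => by simp)
      (fun s m hm => by simp [← hm]))

instance (A : ObjectProperty C) : (Coprod A).IsClosedUnderIsomorphisms where
  of_iso := Coprod.of_iso

lemma Coprod.le_of_closed {A Q : ObjectProperty C} (h : A ≤ Q)
    (h₁ : ∀ T ∈ distTriang C, Q T.obj₁ → Q T.obj₃ → Q T.obj₂)
    (h₂ : ∀ {ι : Type v} (X : ι → C), (∀ i, Q (X i)) → ∀ c : Cofan X, IsColimit c → Q c.pt) :
    Coprod A ≤ Q := by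
  intro X hX
  induction hX with
  | of_mem X hX => exact h _ hX
  | of_triangle T hT _ _ h1 h3 => exact h₁ T hT h1 h3
  | of_coproduct X _ c hc ih => exact h₂ X ih c hc

lemma Coprod.mono {A B : ObjectProperty C} (h : A ≤ B) : Coprod A ≤ Coprod B :=
  Coprod.le_of_closed (fun X hX => .of_mem X (h X hX)) .of_triangle
    (fun X hX c hc => .of_coproduct X hX c hc)

lemma Coprod.shift {A B : ObjectProperty C} (n : ℤ) (h : ∀ Y, A Y → Coprod B (Y⟦n⟧)) {X : C}
    (hX : Coprod A X) : Coprod B (X⟦n⟧) := by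
  refine Coprod.le_of_closed (Q := (Coprod B).shift n) h ?_ ?_ X hX
  · intro T hT h1 h3
    exact .of_triangle _ (Triangle.shift_distinguished T hT n) h1 h3
  · intro ι X hX c hc
    exact .of_coproduct _ hX _ (isColimitCofanMkObjOfIsColimit (shiftFunctor C n) X c.inj
      (IsColimit.ofIsoColimit hc (Cocone.ext (Iso.refl _) (fun ⟨i⟩ => by simp; rfl))))

lemma Coprod.hom_eq_zero {A : ObjectProperty C} {Y : C} (h : ∀ X, A X → ∀ f : X ⟶ Y, f = 0)
    {X : C} (hX : Coprod A X) (f : X ⟶ Y) : f = 0 := by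
  refine Coprod.le_of_closed (Q := fun X => ∀ f : X ⟶ Y, f = 0) h ?_ ?_ X hX f
  · intro T hT h1 h3 f
    obtain ⟨g, rfl⟩ := T.yoneda_exact₂ hT f (h1 _)
    rw [h3 g, comp_zero]
  · intro ι X hX c hc f
    exact Cofan.IsColimit.hom_ext hc _ _ fun i => by
      rw [hX i (c.inj i ≫ f), hX i (c.inj i ≫ 0)]

lemma Coprod.shift_shifts {G : C} {s s' : Set ℤ} (n : ℤ) (h : ∀ j ∈ s, j - n ∈ s') {X : C}
    (hX : Coprod (shifts G s) X) : Coprod (shifts G s') (X⟦n⟧) :=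
  hX.shift n fun _ hY => .of_mem _ (shifts_shift n h hY)

lemma Coprod.of_sigma [HasCoproducts.{v} C] {A : ObjectProperty C} {ι : Type v} (X : ι → C)
    (h : ∀ i, Coprod A (X i)) : Coprod A (∐ X) :=
  .of_coproduct X h _ (coproductIsCoproduct X)

lemma Telescope.coprod [HasCoproducts.{v} C] {E : ℕ → C} {s : ∀ n, E n ⟶ E (n + 1)}
    (Z : Telescope E s) {A : ObjectProperty C} (hA : ∀ Y, A Y → Coprod A (Y⟦(1 : ℤ)⟧))
    (h : ∀ n, Coprod A (E n)) : Coprod A Z.pt := by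
  have h0 : Coprod A (∐ (fun n : ULift.{v} ℕ => E n.down)) := .of_sigma _ fun n => h n.down
  exact .of_triangle _ (rot_of_distTriang _ Z.dist) h0 (h0.shift 1 hA)

end Coprod

/-! ### Approximating cohomological functors by attaching shifts of a compact object -/

section Cohomological

variable (C : Type u) [Category.{v} C] [Preadditive C] [HasZeroObject C] [HasShift C ℤ]
  [∀ (n : ℤ), (shiftFunctor C n).Additive] [Pretriangulated C] [HasCoproducts.{v} C]

/-- A cohomological functor to abelian groups which sends small coproducts to products. -/
structure CohFunctor where
  obj : C → Type v
  [grp : ∀ X, AddCommGroup (obj X)]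
  map {X Y : C} (f : X ⟶ Y) : obj Y →+ obj X
  map_id (X : C) (y : obj X) : map (𝟙 X) y = y
  map_comp {X Y Z : C} (f : X ⟶ Y) (g : Y ⟶ Z) (z : obj Z) : map (f ≫ g) z = map f (map g z)
  map_add {X Y : C} (f g : X ⟶ Y) (y : obj Y) : map (f + g) y = map f y + map g y
  exact (T : Triangle C) (hT : T ∈ distTriang C) (y : obj T.obj₂) (hy : map T.mor₁ y = 0) :
    ∃ z : obj T.obj₃, map T.mor₂ z = y
  coprod_ext {ι : Type v} (X : ι → C) (y : obj (∐ X)) (hy : ∀ i, map (Sigma.ι X i) y = 0) : y = 0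
  coprod_lift {ι : Type v} (X : ι → C) (y : ∀ i, obj (X i)) :
    ∃ z : obj (∐ X), ∀ i, map (Sigma.ι X i) z = y i

attribute [instance] CohFunctor.grp

end Cohomological

namespace CohFunctor

variable {C : Type u} [Category.{v} C] [Preadditive C] [HasZeroObject C] [HasShift C ℤ]
  [∀ (n : ℤ), (shiftFunctor C n).Additive] [Pretriangulated C] [HasCoproducts.{v} C]
  (H : CohFunctor C)

lemma map_sub {X Y : C} (f g : X ⟶ Y) (y : H.obj Y) : H.map (f - g) y = H.map f y - H.map g y := by
  rw [eq_sub_iff_add_eq, ← H.map_add, sub_add_cancel]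

lemma map_zero' {X Y : C} (y : H.obj Y) : H.map (0 : X ⟶ Y) y = 0 := by
  simpa using H.map_sub (0 : X ⟶ Y) 0 y

/-- A compatible family is an element over the coproduct killed by `1 - shift`, so exactness extends
it over the cone. No uniqueness is claimed. -/
lemma exists_telescope {E : ℕ → C} {s : ∀ n, E n ⟶ E (n + 1)} (Z : Telescope E s)
    (x : ∀ n, H.obj (E n)) (hx : ∀ n, H.map (s n) (x (n + 1)) = x n) :
    ∃ z : H.obj Z.pt, ∀ n, H.map (Z.ι n) z = x n := by
  obtain ⟨y, hy⟩ := H.coprod_lift (fun n : ULift.{v} ℕ => E n.down) fun n => x n.down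
  obtain ⟨z, hz⟩ : ∃ z : H.obj Z.pt, H.map Z.π z = y := H.exact _ Z.dist y (by
    refine H.coprod_ext _ _ ?_
    rintro ⟨n⟩
    change H.map _ (H.map (oneSubShift E s) y) = 0
    rw [← H.map_comp, ι_oneSubShift, H.map_sub, H.map_comp, hy, hy]
    exact sub_eq_zero.2 (hx n).symm)
  refine ⟨z, fun n => ?_⟩
  rw [Telescope.ι, H.map_comp, hz]
  exact hy _

/-- Take the cone of the coproduct of all offending maps; `x` restricts to zero along them, so it
extends over the cone. -/
lemma exists_kill (G : C) (s : Set ℤ) (E : C) (x : H.obj E) :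
    ∃ (E' : C) (i : E ⟶ E') (x' : H.obj E'), H.map i x' = x ∧
      (Coprod (shifts G s) E → Coprod (shifts G s) E') ∧
      ∀ j : ℤ, j - 1 ∈ s → ∀ f : G⟦-j⟧ ⟶ E, H.map f x = 0 → f ≫ i = 0 := by
  let ι : Type v := Σ j : {j : ℤ // j - 1 ∈ s}, {f : G⟦-j.1⟧ ⟶ E // H.map f x = 0}
  let W : ι → C := fun a => G⟦-a.1.1⟧
  let d : ∐ W ⟶ E := Sigma.desc fun a => a.2.1
  have hd : ∀ a, Sigma.ι W a ≫ d = a.2.1 := fun a => by simp [d]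
  obtain ⟨E', i, q, hT⟩ := distinguished_cocone_triangle d
  obtain ⟨x', hx'⟩ := H.exact _ hT x (by
    refine H.coprod_ext _ _ fun a => ?_
    change H.map _ (H.map d x) = 0
    rw [← H.map_comp, hd, a.2.2])
  refine ⟨E', i, x', hx', fun hE => ?_, fun j hj f hf => ?_⟩
  -- The cone extends `E` by the suspension of the attached coproduct. Suspension turns index `j`
  -- into `j - 1`, hence the condition `j - 1 ∈ s`.
  · refine .of_triangle _ (rot_of_distTriang _ hT) hE ?_
    refine .of_coproduct _ (fun a => ?_) _ (isColimitShiftCofan _ (coproductIsCoproduct W) 1)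
    exact .of_mem _ (shifts_shift (s := {a.1.1}) 1 (by rintro _ rfl; exact a.1.2)
      (shifts_of_mem G (Set.mem_singleton _)))
  · have h1 : d ≫ i = 0 := comp_distTriang_mor_zero₁₂ _ hT
    have h2 := hd ⟨⟨j, hj⟩, ⟨f, hf⟩⟩ =≫ i
    rw [Category.assoc, h1, comp_zero] at h2
    exact h2.symm

/-- The starting coproduct has one term for each element to be realised, which gives surjectivity.
Iterated killing gives injectivity in the homotopy colimit, since every map from a shift of `G`
comes from a finite stage. Injectivity reaches one index beyond `s`, which is what a cone argument
requires. -/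
theorem exists_approximation {G : C} (hG : MapsFactorFinitely G) {s : Set ℤ}
    (hs : ∀ j ∈ s, j - 1 ∈ s) :
    ∃ (E : C) (x : H.obj E), Coprod (shifts G s) E ∧
      (∀ j ∈ s, ∀ y : H.obj (G⟦-j⟧), ∃ f : G⟦-j⟧ ⟶ E, H.map f x = y) ∧
      ∀ j : ℤ, j - 1 ∈ s → ∀ f : G⟦-j⟧ ⟶ E, H.map f x = 0 → f = 0 := by
  let ι : Type v := Σ j : s, H.obj (G⟦-j.1⟧)
  obtain ⟨x₀, hx₀⟩ := H.coprod_lift (fun a : ι => G⟦-a.1.1⟧) fun a => a.2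
  have step : ∀ p : (Σ E : C, H.obj E), ∃ (q : Σ E : C, H.obj E) (i : p.1 ⟶ q.1),
      H.map i q.2 = p.2 ∧ (Coprod (shifts G s) p.1 → Coprod (shifts G s) q.1) ∧
      ∀ j : ℤ, j - 1 ∈ s → ∀ f : G⟦-j⟧ ⟶ p.1, H.map f p.2 = 0 → f ≫ i = 0 := fun p => by
    obtain ⟨E', i, x', h⟩ := H.exists_kill G s p.1 p.2
    exact ⟨⟨E', x'⟩, i, h⟩
  choose next i hi₁ hi₂ hi₃ using step
  let p : ℕ → Σ E : C, H.obj E := fun n => Nat.rec ⟨_, x₀⟩ (fun _ q => next q) n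
  have hp : ∀ n, Coprod (shifts G s) (p n).1 := by
    intro n
    induction n with
    | zero => exact .of_sigma _ fun a => .of_mem _ (shifts_of_mem G a.1.2)
    | succ n ih => exact hi₂ _ ih
  obtain ⟨Z⟩ := Telescope.nonempty (fun n => (p n).1) (fun n => i (p n))
  obtain ⟨x, hx⟩ := H.exists_telescope Z (fun n => (p n).2) (fun n => hi₁ (p n))
  refine ⟨Z.pt, x, Z.coprod (fun Y hY => .of_mem _ (shifts_shift 1 hs hY)) hp, ?_, ?_⟩
  · intro j hj y
    refine ⟨Sigma.ι (fun a : ι => G⟦-a.1.1⟧) ⟨⟨j, hj⟩, y⟩ ≫ Z.ι 0, ?_⟩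
    rw [H.map_comp, hx]
    exact hx₀ ⟨⟨j, hj⟩, y⟩
  · intro j hj f hf
    obtain ⟨n, g, rfl⟩ := Z.exists_factor (hG.shift (-j)) f
    rw [H.map_comp, hx] at hf
    -- A map defined at stage `n` dies at stage `n + 1`.
    rw [← Z.comp_ι, ← Category.assoc, hi₃ _ j hj g hf, zero_comp]

end CohFunctor

end TStr

namespace TStr

/-! ### The t-structure generated by a compact object -/

section Generators

variable {C : Type u} [Category.{v} C] [Preadditive C]

/-- The maps to a Brown–Comenetz dual of `G` vanish precisely if the maps from `G` vanish. -/
lemma IsBrownComenetzDual.hom_eq_zero_iff {G I : C} (h : IsBrownComenetzDual G I) (X : C) :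
    (∀ f : X ⟶ I, f = 0) ↔ ∀ g : G ⟶ X, g = 0 := by
  obtain ⟨e, -⟩ := h
  constructor
  · intro hX g
    refine CharacterModule.eq_zero_of_character_apply fun φ => ?_
    obtain ⟨f, rfl⟩ := (e X).surjective φ
    rw [hX f, map_zero]
    rfl
  · intro hX f
    refine (e X).injective ?_
    ext g
    rw [hX g, map_zero, map_zero]

variable [HasShift C ℤ]

lemma IsCompactGenerator.mapsFactorFinitely [HasCoproducts.{v} C] {G : C}
    (hG : IsCompactGenerator G) :
    MapsFactorFinitely G := hG.1.mapsFactorFinitely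

variable [∀ (n : ℤ), (shiftFunctor C n).Additive]

lemma IsCompactGenerator.isZero {G : C} (hG : IsCompactGenerator G) {X : C}
    (h : ∀ (j : ℤ) (f : G⟦-j⟧ ⟶ X), f = 0) : IsZero X := by
  refine hG.2 X fun n f => ?_
  apply (shiftFunctor C (-n)).map_injective
  rw [← cancel_mono (shiftShiftNeg X n).hom, Functor.map_zero, zero_comp]
  exact h _ _

variable [HasZeroObject C] [Pretriangulated C]

lemma generatedAisle_shift {G X : C} (h : generatedAisle G X) {n : ℤ} (hn : 0 ≤ n) :
    generatedAisle G (X⟦n⟧) :=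
  h.shift_shifts n fun j hj => by
    simp only [Set.mem_Iic] at hj ⊢
    lia

instance (G : C) : (generatedAisle G).IsClosedUnderIsomorphisms :=
  inferInstanceAs (Coprod _).IsClosedUnderIsomorphisms

end Generators

section Generated

variable {C : Type u} [Category.{v} C] [Preadditive C] [HasZeroObject C] [HasShift C ℤ]
  [∀ (n : ℤ), (shiftFunctor C n).Additive] [Pretriangulated C] [HasCoproducts.{v} C]

/-- The cohomological functor represented by an object. -/
noncomputable def homCohFunctor (X : C) : CohFunctor C where
  obj Y := Y ⟶ X
  map f := Preadditive.leftComp X f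
  map_id _ y := Category.id_comp y
  map_comp f g z := Category.assoc f g z
  map_add f g y := Preadditive.add_comp _ _ _ f g y
  exact T hT y hy := by
    obtain ⟨g, hg⟩ := T.yoneda_exact₂ hT y hy
    exact ⟨g, hg.symm⟩
  coprod_ext X y hy := Sigma.hom_ext _ _ fun i => (hy i).trans comp_zero.symm
  coprod_lift X y := ⟨Sigma.desc y, fun i => Sigma.ι_desc y i⟩

/-- Approximate Hom(-, X). A map from Σ⁻ʲG to the cone has a boundary that desuspends to index `j +
1`, where injectivity still holds; so the map lifts to `X`, and by surjectivity to `E`. -/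
theorem exists_triangle_coprod_shifts {G : C} (hG : MapsFactorFinitely G) {s : Set ℤ}
    (hs : ∀ j ∈ s, j - 1 ∈ s) (X : C) :
    ∃ (E Y : C) (f : E ⟶ X) (g : X ⟶ Y) (h : Y ⟶ E⟦(1 : ℤ)⟧),
      Triangle.mk f g h ∈ distTriang C ∧ Coprod (shifts G s) E ∧
      ∀ j ∈ s, ∀ u : G⟦-j⟧ ⟶ Y, u = 0 := by
  obtain ⟨E, f, hE, h1, h2⟩ := (homCohFunctor X).exists_approximation hG hs
  change E ⟶ X at f
  replace h1 : ∀ j ∈ s, ∀ y : G⟦-j⟧ ⟶ X, ∃ w : G⟦-j⟧ ⟶ E, w ≫ f = y := h1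
  replace h2 : ∀ j : ℤ, j - 1 ∈ s → ∀ w : G⟦-j⟧ ⟶ E, w ≫ f = 0 → w = 0 := h2
  obtain ⟨Y, g, h, hT⟩ := distinguished_cocone_triangle f
  refine ⟨E, Y, f, g, h, hT, hE, fun j hj u => ?_⟩
  have hu : u ≫ h = 0 := by
    let e := shiftShiftIso G (j + 1) 1 j rfl
    obtain ⟨w, hw⟩ := (shiftFunctor C (1 : ℤ)).map_surjective (e.hom ≫ u ≫ h)
    have h3 : h ≫ f⟦(1 : ℤ)⟧' = 0 := comp_distTriang_mor_zero₃₁ _ hT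
    have hwf : w ≫ f = 0 := (shiftFunctor C (1 : ℤ)).map_injective (by
      rw [Functor.map_comp, hw, Functor.map_zero]
      simp [h3])
    rw [h2 _ (by simpa using hj) w hwf, Functor.map_zero] at hw
    rw [← cancel_epi e.hom, ← hw, comp_zero]
  obtain ⟨w, hw⟩ : ∃ w : G⟦-j⟧ ⟶ X, u = w ≫ g := Triangle.coyoneda_exact₃ _ hT u hu
  obtain ⟨w', rfl⟩ := h1 j hj w
  have h3 : f ≫ g = 0 := comp_distTriang_mor_zero₁₂ _ hT
  rw [hw, Category.assoc, h3, comp_zero]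

/-- With every shift allowed, the cone receives no nonzero map from any shift of `G`, so it
vanishes. -/
theorem IsCompactGenerator.coprod_shifts_univ {G : C} (hG : IsCompactGenerator G) (X : C) :
    Coprod (shifts G Set.univ) X := by
  obtain ⟨E, Y, f, g, h, hT, hE, hY⟩ := exists_triangle_coprod_shifts hG.mapsFactorFinitely
    (s := Set.univ) (fun _ _ => trivial) X
  have hf : IsIso f := (Triangle.isZero₃_iff_isIso₁ _ hT).1 (hG.isZero fun j => hY j trivial)
  exact hE.of_iso (asIso f)

/-- The t-structure with aisle `generatedAisle G`. -/
noncomputable def generatedTStructure (G : C) (hG : MapsFactorFinitely G) : TStructure C where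
  le n := (generatedAisle G).shift n
  -- The offset makes `ge 1` the right orthogonal of the aisle.
  ge n := (generatedAisle G).rightOrthogonal.shift (n - 1)
  le_shift n a n' h X hX := by
    rw [← ObjectProperty.shift_shift _ a n' n h] at hX
    exact hX
  ge_shift n a n' h X hX := by
    rw [← ObjectProperty.shift_shift _ a (n' - 1) (n - 1) (by lia)] at hX
    exact hX
  zero' X Y f hX hY := by
    rw [ObjectProperty.shift_zero] at hX
    rw [sub_self, ObjectProperty.shift_zero] at hY
    exact hY f hX
  le_zero_le := by
    rw [ObjectProperty.shift_zero]
    exact fun X hX => generatedAisle_shift hX zero_le_one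
  ge_one_le := by
    rw [sub_self, ObjectProperty.shift_zero]
    intro Y hY X f hX
    apply (shiftFunctor C (1 : ℤ)).map_injective
    rw [← cancel_mono (shiftNegShift Y (1 : ℤ)).hom, Functor.map_zero, zero_comp]
    exact hY _ (generatedAisle_shift hX zero_le_one)
  exists_triangle_zero_one X := by
    obtain ⟨E, Y, f, g, h, hT, hE, hY⟩ := exists_triangle_coprod_shifts hG
      (s := Set.Iic 0) (fun j hj => by simp only [Set.mem_Iic] at hj ⊢; lia) X
    refine ⟨E, Y, ?_, ?_, f, g, h, hT⟩
    · rw [ObjectProperty.shift_zero]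
      exact hE
    · rw [sub_self, ObjectProperty.shift_zero]
      exact fun X q hX => hX.hom_eq_zero (shifts_hom_eq_zero hY) q

lemma generatedTStructure_le_zero (G : C) (hG : MapsFactorFinitely G) :
    (generatedTStructure G hG).le 0 = generatedAisle G :=
  ObjectProperty.shift_zero _ ℤ

lemma isPreferred_generatedTStructure {G : C} (hG : IsCompactGenerator G) :
    IsPreferred (generatedTStructure G hG.mapsFactorFinitely) := by
  refine ⟨G, hG, 1, one_pos, ?_, ?_⟩ <;>
  · rw [← generatedTStructure_le_zero G hG.mapsFactorFinitely]
    exact TStructure.le_monotone _ (by norm_num)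

end Generated

/-! ### Brown representability -/

section Brown

variable {C : Type u} [Category.{v} C] [Preadditive C] [HasZeroObject C] [HasShift C ℤ]
  [∀ (n : ℤ), (shiftFunctor C n).Additive] [Pretriangulated C] [HasCoproducts.{v} C]
  (H : CohFunctor C)

namespace CohFunctor

/-- The map `Hom(Y, E) → H(Y)` given by an element of `H(E)`. -/
def yonedaMap {E : C} (x : H.obj E) (Y : C) : (Y ⟶ E) →+ H.obj Y :=
  AddMonoidHom.mk' (fun f => H.map f x) fun f g => H.map_add f g x

lemma yonedaMap_comp {E : C} (x : H.obj E) {Y Y' : C} (f : Y ⟶ Y') (g : Y' ⟶ E) :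
    H.yonedaMap x Y (f ≫ g) = H.map f (H.yonedaMap x Y' g) := H.map_comp f g x

variable {H} {E : C} {x : H.obj E}

lemma bijective_yonedaMap_of_iso {Y Y' : C} (e : Y ≅ Y')
    (h : Function.Bijective (H.yonedaMap x Y)) : Function.Bijective (H.yonedaMap x Y') := by
  constructor
  · rw [injective_iff_map_eq_zero]
    intro f hf
    rw [← cancel_epi e.hom, comp_zero]
    refine (injective_iff_map_eq_zero _).1 h.1 _ ?_
    rw [yonedaMap_comp, hf, map_zero]
  · intro y
    obtain ⟨f, hf⟩ := h.2 (H.map e.hom y)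
    refine ⟨e.inv ≫ f, ?_⟩
    rw [yonedaMap_comp, hf, ← H.map_comp, e.inv_hom_id, H.map_id]

/-- The five lemma. The outer terms of the long exact sequence are the values at the shifted
vertices, and only half of bijectivity is needed there. -/
lemma bijective_yonedaMap_of_triangle {T : Triangle C} (hT : T ∈ distTriang C)
    (h₁ : Function.Bijective (H.yonedaMap x T.obj₁))
    (h₁' : Function.Surjective (H.yonedaMap x (T.obj₁⟦(1 : ℤ)⟧)))
    (h₃ : Function.Bijective (H.yonedaMap x T.obj₃))
    (h₃' : Function.Injective (H.yonedaMap x (T.obj₃⟦(-1 : ℤ)⟧))) :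
    Function.Bijective (H.yonedaMap x T.obj₂) := by
  constructor
  · rw [injective_iff_map_eq_zero]
    intro f hf
    obtain ⟨g, rfl⟩ := T.yoneda_exact₂ hT f ((injective_iff_map_eq_zero _).1 h₁.1 _ (by
      rw [yonedaMap_comp, hf, map_zero]))
    rw [yonedaMap_comp] at hf
    obtain ⟨w, hw⟩ := H.exact _ (rot_of_distTriang _ hT) _ hf
    obtain ⟨k, rfl⟩ := h₁' w
    have hk : H.yonedaMap x T.obj₃ (T.mor₃ ≫ k) = H.yonedaMap x T.obj₃ g :=
      (yonedaMap_comp _ _ _ _).trans hw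
    rw [← h₃.1 hk, ← Category.assoc, comp_distTriang_mor_zero₂₃ _ hT, zero_comp]
  · intro y
    obtain ⟨f₁, hf₁⟩ := h₁.2 (H.map T.mor₁ y)
    have hinv := inv_rot_of_distTriang _ hT
    have hz : T.invRotate.mor₁ ≫ T.mor₁ = 0 := comp_distTriang_mor_zero₁₂ _ hinv
    -- The obstruction to extending `f₁` lives on `T.obj₃⟦-1⟧`; its image in `H` vanishes because
    -- `f₁` represents a restriction of `y`.
    obtain ⟨f₂, rfl⟩ : ∃ f₂ : T.obj₂ ⟶ E, f₁ = T.mor₁ ≫ f₂ :=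
      T.invRotate.yoneda_exact₂ hinv f₁ ((injective_iff_map_eq_zero _).1 h₃' _ (by
        refine (yonedaMap_comp _ _ T.invRotate.mor₁ f₁).trans ?_
        refine (congrArg _ hf₁).trans ?_
        refine (H.map_comp T.invRotate.mor₁ T.mor₁ y).symm.trans ?_
        rw [hz, H.map_zero']
        rfl))
    obtain ⟨z, hz⟩ := H.exact _ hT (y - H.yonedaMap x _ f₂) (by
      rw [_root_.map_sub, ← yonedaMap_comp, hf₁, sub_self])
    obtain ⟨f₃, rfl⟩ := h₃.2 z
    refine ⟨f₂ + T.mor₂ ≫ f₃, ?_⟩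
    rw [_root_.map_add, yonedaMap_comp, hz]
    abel

lemma bijective_yonedaMap_of_coproduct {ι : Type v} (X : ι → C)
    (h : ∀ i, Function.Bijective (H.yonedaMap x (X i))) :
    Function.Bijective (H.yonedaMap x (∐ X)) := by
  constructor
  · rw [injective_iff_map_eq_zero]
    intro f hf
    refine Sigma.hom_ext _ _ fun i => ?_
    rw [comp_zero]
    refine (injective_iff_map_eq_zero _).1 (h i).1 _ ?_
    rw [yonedaMap_comp, hf, map_zero]
  · intro y
    choose f hf using fun i => (h i).2 (H.map (Sigma.ι X i) y)
    refine ⟨Sigma.desc f, sub_eq_zero.1 (H.coprod_ext _ _ fun i => ?_)⟩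
    rw [_root_.map_sub, ← yonedaMap_comp, Sigma.ι_desc, hf, sub_self]

variable (H) in
/-- Brown representability. -/
theorem exists_bijective_yonedaMap {G : C} (hG : IsCompactGenerator G) :
    ∃ (E : C) (x : H.obj E), ∀ Y, Function.Bijective (H.yonedaMap x Y) := by
  obtain ⟨E, x, -, h1, h2⟩ := H.exists_approximation hG.mapsFactorFinitely
    (s := Set.univ) (fun _ _ => trivial)
  -- All shifts must be carried through the induction, because the five lemma refers to shifts of
  -- the outer vertices.
  have key : Coprod (shifts G Set.univ) ≤
      fun Y => ∀ n : ℤ, Function.Bijective (H.yonedaMap x (Y⟦n⟧)) := by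
    refine Coprod.le_of_closed ?_ ?_ ?_
    · rintro Y ⟨j, -, ⟨e⟩⟩ n
      refine bijective_yonedaMap_of_iso
        ((shiftFunctor C n).mapIso e ≪≫ shiftShiftIso G j n (j - n) (by lia)).symm ⟨?_, ?_⟩
      · rw [injective_iff_map_eq_zero]
        exact h2 (j - n) trivial
      · exact h1 (j - n) trivial
    · intro T hT k1 k3 n
      refine bijective_yonedaMap_of_triangle (Triangle.shift_distinguished T hT n) (k1 n) ?_
        (k3 n) ?_
      · exact (bijective_yonedaMap_of_iso
          ((shiftFunctorAdd' C n 1 (n + 1) rfl).app T.obj₁) (k1 (n + 1))).2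
      · exact (bijective_yonedaMap_of_iso
          ((shiftFunctorAdd' C n (-1) (n + -1) rfl).app T.obj₃) (k3 (n + -1))).1
    · intro ι X hX c hc n
      have e : (∐ X)⟦n⟧ ≅ ∐ fun i => (X i)⟦n⟧ := PreservesCoproduct.iso (shiftFunctor C n) X
      refine bijective_yonedaMap_of_iso (e.symm ≪≫ (shiftFunctor C n).mapIso
        ((coproductIsCoproduct X).coconePointUniqueUpToIso hc))
        (bijective_yonedaMap_of_coproduct _ fun i => hX i n)
  exact ⟨E, x, fun Y => bijective_yonedaMap_of_iso ((shiftFunctorZero C ℤ).app Y)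
    (key Y (hG.coprod_shifts_univ Y) 0)⟩

end CohFunctor

end Brown

/-! ### Brown–Comenetz duals -/

section BrownComenetz

/-- `φ` descends to the quotient by the kernel of `p`, which embeds in `B`; injectivity of ℚ/ℤ
extends it. -/
lemma exists_extension_of_ker_le {A B : Type*} [AddCommGroup A] [AddCommGroup B] (p : A →+ B)
    (φ : A →+ AddCircle (1 : ℚ)) (h : ∀ a, p a = 0 → φ a = 0) :
    ∃ ψ : B →+ AddCircle (1 : ℚ), ∀ a, ψ (p a) = φ a := by
  let q : A ⧸ p.ker →+ B := QuotientAddGroup.kerLift p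
  let φ' : A ⧸ p.ker →+ AddCircle (1 : ℚ) := QuotientAddGroup.lift p.ker φ h
  obtain ⟨ψ, hψ⟩ := CharacterModule.dual_surjective_of_injective (R := ℤ) q.toIntLinearMap
    (QuotientAddGroup.kerLift_injective p) φ'
  exact ⟨ψ, fun a => DFunLike.congr_fun hψ (QuotientAddGroup.mk a)⟩

variable {C : Type u} [Category.{v} C] [Preadditive C] [HasCoproducts.{v} C]

lemma MapsFactorFinitely.addMonoidHom_eq_zero {c : C} (hc : MapsFactorFinitely c) {ι : Type v}
    {X : ι → C} {B : Type*} [AddCommGroup B] (φ : (c ⟶ ∐ X) →+ B)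
    (h : ∀ (i : ι) (g : c ⟶ X i), φ (g ≫ Sigma.ι X i) = 0) : φ = 0 := by
  ext f
  obtain ⟨s, hs⟩ := hc X f
  rw [← hs, finProj, Preadditive.comp_sum, map_sum, Finset.sum_eq_zero, AddMonoidHom.zero_apply]
  intro i _
  rw [← Category.assoc, h]

/-- Sum the given homomorphisms over the components of a map; finite factorization leaves only
finitely many nonzero summands. -/
lemma MapsFactorFinitely.exists_addMonoidHom {c : C} (hc : MapsFactorFinitely c) {ι : Type v}
    {X : ι → C} {B : Type*} [AddCommGroup B] (φ : ∀ i, (c ⟶ X i) →+ B) :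
    ∃ ψ : (c ⟶ ∐ X) →+ B, ∀ (i : ι) (g : c ⟶ X i), ψ (g ≫ Sigma.ι X i) = φ i g := by
  have hfin : ∀ f : c ⟶ ∐ X,
      (Function.support fun i => φ i (f ≫ coprodProj X i)).Finite := by
    intro f
    obtain ⟨s, hs⟩ := hc X f
    refine s.finite_toSet.subset fun i hi => ?_
    by_contra hs'
    refine hi ?_
    dsimp only
    rw [← hs, finProj, Preadditive.comp_sum, Preadditive.sum_comp, Finset.sum_eq_zero, map_zero]
    intro j hj
    rw [Category.assoc, Category.assoc, ι_coprodProj_of_ne X (by rintro rfl; exact hs' hj),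
      comp_zero, comp_zero]
  refine ⟨AddMonoidHom.mk' (fun f => ∑ᶠ i, φ i (f ≫ coprodProj X i)) fun f g => ?_, ?_⟩
  · rw [← finsum_add_distrib (hfin f) (hfin g)]
    simp
  · intro i g
    change ∑ᶠ j, φ j ((g ≫ Sigma.ι X i) ≫ coprodProj X j) = _
    rw [finsum_eq_single _ i]
    · rw [Category.assoc, ι_coprodProj_self, Category.comp_id]
    · intro j hj
      rw [Category.assoc, ι_coprodProj_of_ne X hj.symm, comp_zero, map_zero]

variable [HasZeroObject C] [HasShift C ℤ]
  [∀ (n : ℤ), (shiftFunctor C n).Additive] [Pretriangulated C]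

/-- The functor which is represented by the Brown–Comenetz duals of `G`. -/
noncomputable def brownComenetzFunctor (G : C) (hG : MapsFactorFinitely G) : CohFunctor C where
  obj Y := (G ⟶ Y) →+ AddCircle (1 : ℚ)
  map f := AddMonoidHom.compHom' (Preadditive.rightComp G f)
  map_id Y φ := by
    ext g
    exact congrArg φ (Category.comp_id g)
  map_comp f g φ := by
    ext k
    exact congrArg φ (Category.assoc k f g).symm
  map_add f g φ := by
    ext k
    exact (congrArg φ (Preadditive.comp_add _ _ _ k f g)).trans (map_add φ _ _)
  exact T hT φ hφ := by
    obtain ⟨ψ, hψ⟩ := exists_extension_of_ker_le (Preadditive.rightComp G T.mor₂) φ (by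
      intro a ha
      obtain ⟨b, rfl⟩ := T.coyoneda_exact₂ hT a ha
      exact DFunLike.congr_fun hφ b)
    exact ⟨ψ, by ext a; exact hψ a⟩
  coprod_ext X φ hφ := hG.addMonoidHom_eq_zero φ fun i g => DFunLike.congr_fun (hφ i) g
  coprod_lift X φ := by
    obtain ⟨ψ, hψ⟩ := hG.exists_addMonoidHom φ
    exact ⟨ψ, fun i => by ext g; exact hψ i g⟩

theorem exists_isBrownComenetzDual {G : C} (hG : IsCompactGenerator G) :
    ∃ I : C, IsBrownComenetzDual G I := by
  let H := brownComenetzFunctor G hG.mapsFactorFinitely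
  obtain ⟨I, x, hx⟩ := H.exists_bijective_yonedaMap hG
  refine ⟨I, fun X => AddEquiv.ofBijective (H.yonedaMap x X) (hx X), fun X Y f g φ => ?_⟩
  exact DFunLike.congr_fun (F := (G ⟶ X) →+ AddCircle (1 : ℚ)) (H.yonedaMap_comp x f g) φ

end BrownComenetz

end TStr

namespace TStr

open scoped ZeroObject

section ShiftHom

variable {C : Type u} [Category.{v} C] [Preadditive C]

lemma retractClosure_hom_eq_zero {A : ObjectProperty C} {Y : C}
    (h : ∀ X, A X → ∀ f : X ⟶ Y, f = 0) {X : C} (hX : A.retractClosure X) (f : X ⟶ Y) :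
    f = 0 := by
  obtain ⟨Z, hZ, ⟨r⟩⟩ := hX
  rw [← Category.id_comp f, ← r.retract, Category.assoc, h Z hZ (r.r ≫ f), comp_zero]

variable [HasShift C ℤ] [∀ (n : ℤ), (shiftFunctor C n).Additive]

lemma hom_shift_eq_zero_iff (X Y : C) (n m : ℤ) (h : n + m = 0) :
    (∀ f : X⟦n⟧ ⟶ Y, f = 0) ↔ ∀ f : X ⟶ Y⟦m⟧, f = 0 := by
  obtain rfl : m = -n := by lia
  constructor
  · intro H f
    apply (shiftFunctor C n).map_injective
    rw [← cancel_mono (shiftNegShift Y n).hom, Functor.map_zero, zero_comp]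
    exact H _
  · intro H f
    apply (shiftFunctor C (-n)).map_injective
    rw [← cancel_epi (shiftShiftNeg X n).inv, Functor.map_zero, comp_zero]
    exact H _

end ShiftHom

/-! ### Compact objects as summands of boundedly generated ones -/

section Compact

variable {C : Type u} [Category.{v} C] [Preadditive C] [HasZeroObject C] [HasShift C ℤ]
  [∀ (n : ℤ), (shiftFunctor C n).Additive] [Pretriangulated C] [HasCoproducts.{v} C]

/-- The objects with finitary maps to coproducts in `Coprod(G[-n, n])` for some `n`. -/
def smallBounded (G : C) : ObjectProperty C :=
  fun k => MapsFactorFinitely k ∧ ∃ n : ℤ, Coprod (shifts G (Set.Icc (-n) n)) k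

lemma smallBounded_of_triangle {G : C} {T : Triangle C} (hT : T ∈ distTriang C)
    (h₁ : smallBounded G T.obj₁) (h₃ : smallBounded G T.obj₃) : smallBounded G T.obj₂ := by
  obtain ⟨h₁, n₁, k₁⟩ := h₁
  obtain ⟨h₃, n₃, k₃⟩ := h₃
  refine ⟨h₁.of_triangle hT h₃, max n₁ n₃, .of_triangle T hT
    (Coprod.mono (shifts_mono G (Set.Icc_subset_Icc ?_ ?_)) _ k₁)
    (Coprod.mono (shifts_mono G (Set.Icc_subset_Icc ?_ ?_)) _ k₃)⟩ <;> simp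

lemma smallBounded_of_isZero (G : C) {X : C} (hX : IsZero X) : smallBounded G X :=
  ⟨.of_isZero hX, 0, .of_isZero _ hX⟩

/-- The morphism `f` factors through an object of `smallBounded G`. -/
def FactorsThroughSmall (G : C) {X Y : C} (f : X ⟶ Y) : Prop :=
  ∃ (k : C) (a : X ⟶ k) (b : k ⟶ Y), smallBounded G k ∧ a ≫ b = f

lemma FactorsThroughSmall.comp {G X Y Z : C} {f : X ⟶ Y} (h : FactorsThroughSmall G f)
    (g : Y ⟶ Z) : FactorsThroughSmall G (f ≫ g) := by
  obtain ⟨k, a, b, hk, rfl⟩ := h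
  exact ⟨k, a, b ≫ g, hk, (Category.assoc _ _ _).symm⟩

lemma FactorsThroughSmall.zero (G X Y : C) : FactorsThroughSmall G (0 : X ⟶ Y) :=
  ⟨0, 0, 0, smallBounded_of_isZero G (isZero_zero C), comp_zero⟩

lemma FactorsThroughSmall.add {G X Y : C} {f g : X ⟶ Y} (hf : FactorsThroughSmall G f)
    (hg : FactorsThroughSmall G g) : FactorsThroughSmall G (f + g) := by
  obtain ⟨k, a, b, hk, rfl⟩ := hf
  obtain ⟨k', a', b', hk', rfl⟩ := hg
  exact ⟨k ⊞ k', biprod.lift a a', biprod.desc b b',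
    smallBounded_of_triangle (binaryBiproductTriangle_distinguished k k') hk hk', by simp⟩

lemma FactorsThroughSmall.sum {G X Y : C} {ι : Type*} (s : Finset ι) (f : ι → (X ⟶ Y))
    (hf : ∀ i, FactorsThroughSmall G (f i)) : FactorsThroughSmall G (∑ i ∈ s, f i) :=
  Finset.sum_induction _ _ (fun _ _ => .add) (.zero G X Y) fun i _ => hf i

/-- Factor the image in the third vertex through a small `K`. The fibre `c'` of `c ⟶ K` still has
finitary maps, so its map to the first vertex factors through a small `L`. An extension `M` of `K`
by `L` then carries `f`, up to a correction. -/
lemma factorsThroughSmall_of_triangle {G : C} {T : Triangle C} (hT : T ∈ distTriang C)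
    (h₁ : ∀ c : C, MapsFactorFinitely c → ∀ f : c ⟶ T.obj₁, FactorsThroughSmall G f)
    (h₃ : ∀ c : C, MapsFactorFinitely c → ∀ f : c ⟶ T.obj₃, FactorsThroughSmall G f)
    {c : C} (hc : MapsFactorFinitely c) (f : c ⟶ T.obj₂) : FactorsThroughSmall G f := by
  obtain ⟨K, a, b, hK, hab⟩ := h₃ c hc (f ≫ T.mor₂)
  obtain ⟨c', p, d, hU⟩ := distinguished_cocone_triangle₁ a
  have hc' : MapsFactorFinitely c' :=
    MapsFactorFinitely.of_triangle (inv_rot_of_distTriang _ hU) (hK.1.shift (-1)) hc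
  obtain ⟨q, hq, hq'⟩ := complete_distinguished_triangle_morphism₁ _ _ hU hT f b hab
  change c' ⟶ T.obj₁ at q
  change p ≫ f = q ≫ T.mor₁ at hq
  change d ≫ q⟦(1 : ℤ)⟧' = b ≫ T.mor₃ at hq'
  obtain ⟨L, a', b', hL, rfl⟩ := h₁ c' hc' q
  obtain ⟨M, i, π, hV⟩ := distinguished_cocone_triangle₂ (d ≫ a'⟦(1 : ℤ)⟧')
  obtain ⟨r, hr, hr'⟩ := complete_distinguished_triangle_morphism₂ _ _ hU hV a' (𝟙 K)
    (Category.id_comp _).symm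
  change c ⟶ M at r
  change p ≫ r = a' ≫ i at hr
  change a ≫ 𝟙 K = r ≫ π at hr'
  rw [Category.comp_id] at hr'
  obtain ⟨w, hw, -⟩ := complete_distinguished_triangle_morphism₂ _ _ hV hT b' b (by
    change (d ≫ a'⟦(1 : ℤ)⟧') ≫ b'⟦(1 : ℤ)⟧' = b ≫ T.mor₃
    rw [← hq', Functor.map_comp, Category.assoc])
  change M ⟶ T.obj₂ at w
  change i ≫ w = b' ≫ T.mor₁ at hw
  -- `f` and `r ≫ w` agree on `c'`, so their difference factors through `a`. As `a = r ≫ π`, the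
  -- correction also passes through `M`.
  obtain ⟨h, hh⟩ : ∃ h : K ⟶ T.obj₂, f - r ≫ w = a ≫ h :=
    Triangle.yoneda_exact₂ _ hU (f - r ≫ w) (by
      change p ≫ (f - r ≫ w) = 0
      rw [Preadditive.comp_sub, hq, ← Category.assoc p, hr, Category.assoc, Category.assoc, hw,
        sub_self])
  refine ⟨M, r, w + π ≫ h, smallBounded_of_triangle hV hL hK, ?_⟩
  rw [Preadditive.comp_add, ← Category.assoc r, ← hr', ← hh]
  abel

theorem IsCompactGenerator.factorsThroughSmall {G : C} (hG : IsCompactGenerator G) {c X : C}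
    (hc : MapsFactorFinitely c) (f : c ⟶ X) : FactorsThroughSmall G f := by
  refine Coprod.le_of_closed (A := shifts G Set.univ)
    (Q := fun X => ∀ c : C, MapsFactorFinitely c → ∀ f : c ⟶ X, FactorsThroughSmall G f)
    ?_ ?_ ?_ X (hG.coprod_shifts_univ X) c hc f
  · rintro X ⟨j, -, ⟨e⟩⟩ c - f
    exact ⟨G⟦-j⟧, f ≫ e.hom, e.inv, ⟨hG.mapsFactorFinitely.shift _, |j|,
      .of_mem _ (shifts_of_mem G (Set.mem_Icc.2 ⟨neg_abs_le j, le_abs_self j⟩))⟩, by simp⟩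
  · exact fun T hT h₁ h₃ c hc f => factorsThroughSmall_of_triangle hT h₁ h₃ hc f
  · intro ι X hX c hc d hd f
    let e := (coproductIsCoproduct X).coconePointUniqueUpToIso hc
    obtain ⟨s, hs⟩ := hd X (f ≫ e.inv)
    have h : FactorsThroughSmall G (f ≫ e.inv) := by
      rw [← hs, finProj, Preadditive.comp_sum]
      refine .sum s _ fun i => ?_
      rw [← Category.assoc]
      exact (hX i d hd _).comp _
    simpa using h.comp e.hom

/-- A compact object is a direct summand of an object of `Coprod(G[-n, n])`. -/
theorem IsCompactGenerator.exists_retractClosure {G : C} (hG : IsCompactGenerator G) {c : C}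
    (hc : MapsFactorFinitely c) :
    ∃ n : ℤ, 0 < n ∧ (Coprod (shifts G (Set.Icc (-n) n))).retractClosure c := by
  obtain ⟨k, a, b, ⟨-, n, hk⟩, h⟩ := hG.factorsThroughSmall hc (𝟙 c)
  refine ⟨max n 1, by simp, k, Coprod.mono (shifts_mono G (Set.Icc_subset_Icc ?_ ?_)) _ hk,
    ⟨⟨a, b, h⟩⟩⟩ <;> simp

end Compact

/-! ### Comparison of preferred t-structures -/

section Compare

variable {C : Type u} [Category.{v} C] [Preadditive C] [HasZeroObject C] [HasShift C ℤ]
  [∀ (n : ℤ), (shiftFunctor C n).Additive] [Pretriangulated C]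

lemma retractClosure_coprod_shifts_hom_eq_zero {G : C} {s : Set ℤ} {Y : C}
    (h : ∀ j ∈ s, ∀ f : G⟦-j⟧ ⟶ Y, f = 0) {X : C}
    (hX : (Coprod (shifts G s)).retractClosure X) (f : X ⟶ Y) : f = 0 :=
  retractClosure_hom_eq_zero (fun _ hZ f => hZ.hom_eq_zero (shifts_hom_eq_zero h) f) hX f

variable (t t' : TStructure C)

lemma tle_of_orthogonal (n : ℤ) (X : C)
    (h : ∀ Y, t.ge (n + 1) Y → ∀ f : X ⟶ Y, f = 0) : t.le n X := by
  rw [t.le_iff_isLE, t.isLE_iff_orthogonal n (n + 1) rfl]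
  exact fun Y f hY => h Y hY.ge f

lemma tge_of_orthogonal (n : ℤ) (X : C)
    (h : ∀ Y, t.le (n - 1) Y → ∀ f : Y ⟶ X, f = 0) : t.ge n X := by
  rw [t.ge_iff_isGE, t.isGE_iff_orthogonal (n - 1) n (by lia)]
  exact fun Y f hY => h Y hY.le f

lemma hom_eq_zero_of_le_of_ge {n m : ℤ} (h : n < m) {X Y : C} (hX : t.le n X) (hY : t.ge m Y)
    (f : X ⟶ Y) : f = 0 :=
  t.zero_of_isLE_of_isGE f n m h ⟨hX⟩ ⟨hY⟩

lemma coprod_le_tle {A : ObjectProperty C} {n : ℤ} (h : A ≤ t.le n) : Coprod A ≤ t.le n :=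
  fun X hX => tle_of_orthogonal t n X fun _ hY f =>
    hX.hom_eq_zero (fun Z hZ f => hom_eq_zero_of_le_of_ge t (by lia) (h Z hZ) hY f) f

lemma retractClosure_le_tle {A : ObjectProperty C} {n : ℤ} (h : A ≤ t.le n) :
    A.retractClosure ≤ t.le n :=
  fun X hX => tle_of_orthogonal t n X fun _ hY f =>
    retractClosure_hom_eq_zero (fun Z hZ f => hom_eq_zero_of_le_of_ge t (by lia) (h Z hZ) hY f)
      hX f

lemma tle_shift_iff (n a m : ℤ) (h : a + m = n) (X : C) : t.le m (X⟦a⟧) ↔ t.le n X := by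
  rw [t.le_iff_isLE, t.le_iff_isLE, t.isLE_shift_iff X n a m h]

lemma tge_shift_iff (n a m : ℤ) (h : a + m = n) (X : C) : t.ge m (X⟦a⟧) ↔ t.ge n X := by
  rw [t.ge_iff_isGE, t.ge_iff_isGE, t.isGE_shift_iff X n a m h]

lemma shifts_le_tle {G : C} {n m : ℤ} {s : Set ℤ} (hG : t.le n G) (hs : ∀ j ∈ s, n + j ≤ m) :
    shifts G s ≤ t.le m := by
  rintro X ⟨j, hj, ⟨e⟩⟩
  exact ((t.le m).prop_iff_of_iso e).2 (t.le_monotone (hs j hj) _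
    ((tle_shift_iff t n (-j) (n + j) (by lia) G).2 hG))

lemma generatedAisle_le_tle {G : C} {n : ℤ} (hG : t.le n G) : generatedAisle G ≤ t.le n :=
  coprod_le_tle t (shifts_le_tle t hG fun j hj => by simp only [Set.mem_Iic] at hj; lia)

variable {t t'}

lemma tle_le_add {n m : ℤ} (h : t.le n ≤ t'.le m) (k : ℤ) : t.le (n + k) ≤ t'.le (m + k) := by
  intro X hX
  rw [← tle_shift_iff t' (m + k) k m (by lia)]
  exact h _ ((tle_shift_iff t (n + k) k n (by lia) X).2 hX)

lemma tge_le_of_tle_le {n m : ℤ} (h : t.le n ≤ t'.le m) : t'.ge (m + 1) ≤ t.ge (n + 1) :=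
  fun Y hY => tge_of_orthogonal t (n + 1) Y fun X hX f =>
    hom_eq_zero_of_le_of_ge t' (lt_add_one m) (h X (by rwa [add_sub_cancel_right] at hX)) hY f

variable [HasCoproducts.{v} C]

/-- A compact generator is bounded above for the preferred t-structures. -/
lemma IsPreferred.exists_le (ht : IsPreferred t) {H : C} (hH : MapsFactorFinitely H) :
    ∃ n : ℤ, 0 < n ∧ t.le n H := by
  obtain ⟨G, hG, N, hN, -, h⟩ := ht
  obtain ⟨n, hn, hr⟩ := hG.exists_retractClosure hH
  refine ⟨N + n, by lia, retractClosure_le_tle t (coprod_le_tle t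
    (shifts_le_tle t (h G (.of_mem _ ⟨0, by simp, ⟨?_⟩⟩)) fun j hj => ?_)) _ hr⟩
  · exact (shiftFunctorZero' C (-0 : ℤ) (by simp)).symm.app G
  · have := hj.2
    lia

/-- Independence of the generator: `G` is bounded above for the t-structure generated by `H`, and
`H` is bounded above for `t`. -/
lemma IsPreferred.compare (ht : IsPreferred t) {H : C} (hH : IsCompactGenerator H) :
    ∃ N : ℤ, 0 < N ∧ t.le (-N) ≤ generatedAisle H ∧ generatedAisle H ≤ t.le N := by
  obtain ⟨n, hn, hHn⟩ := ht.exists_le hH.mapsFactorFinitely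
  obtain ⟨G, hG, N, hN, h, -⟩ := ht
  let tH := generatedTStructure H hH.mapsFactorFinitely
  obtain ⟨m, hm, hGm⟩ := (isPreferred_generatedTStructure hH).exists_le hG.mapsFactorFinitely
  have h1 : t.le (-N) ≤ tH.le m := h.trans (generatedAisle_le_tle tH hGm)
  have h2 : t.le (-N + -m) ≤ generatedAisle H := by
    rw [← generatedTStructure_le_zero H hH.mapsFactorFinitely, ← add_neg_cancel m]
    exact tle_le_add h1 (-m)
  refine ⟨N + m + n, by lia, (t.le_monotone (by lia)).trans h2,
    (generatedAisle_le_tle t hHn).trans (t.le_monotone (by lia))⟩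

lemma IsPreferred.exists_le_le (ht : IsPreferred t) (ht' : IsPreferred t') :
    ∃ N : ℤ, 0 < N ∧ t.le 0 ≤ t'.le N := by
  have ⟨G, hG, _⟩ := id ht
  obtain ⟨N, hN, h, -⟩ := ht.compare hG
  obtain ⟨N', hN', -, h'⟩ := ht'.compare hG
  refine ⟨N' + N, by lia, ?_⟩
  have := tle_le_add (h.trans h') N
  rwa [neg_add_cancel] at this

end Compare

end TStr

namespace TStr

/-! ### Detecting bounds by maps from the generator -/

section WeakApproximation

variable {C : Type u} [Category.{v} C] [Preadditive C] [HasZeroObject C] [HasShift C ℤ]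
  [∀ (n : ℤ), (shiftFunctor C n).Additive] [Pretriangulated C]

/-- The data in the definition of weak approximability. -/
structure WeakApproximation (A : ℤ) (G : C) (t : TStructure C) : Prop where
  pos : 0 < A
  gen : IsCompactGenerator G
  le : t.le A G
  hom_eq_zero : ∀ (X : C) (f : G ⟶ X), t.le (-A) X → f = 0
  approx : ∀ F : C, t.le 0 F →
    ∃ (E D : C) (f : E ⟶ F) (g : F ⟶ D) (h : D ⟶ E⟦(1 : ℤ)⟧),
      Triangle.mk f g h ∈ distTriang C ∧
      (Coprod (shifts G (Set.Icc (-A) A))).retractClosure E ∧ t.le (-1) D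

lemma IsWeaklyApproximable.exists_weakApproximation (h : IsWeaklyApproximable C) :
    ∃ (A : ℤ) (G : C) (t : TStructure C), WeakApproximation A G t := by
  obtain ⟨A, G, t, h1, h2, h3, h4, h5⟩ := h
  exact ⟨A, G, t, h1, h2, h3, h4, h5⟩

namespace WeakApproximation

variable {A : ℤ} {G : C} {t : TStructure C} (w : WeakApproximation A G t)

include w

lemma shift_hom_eq_zero {X : C} {n j : ℤ} (hX : t.le n X) (hj : n + A ≤ j) (f : G⟦-j⟧ ⟶ X) :
    f = 0 :=
  (hom_shift_eq_zero_iff G X (-j) j (by lia)).2 (fun f => w.hom_eq_zero _ f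
    (t.le_monotone (by lia) _ ((tle_shift_iff t n j (n - j) (by lia) X).2 hX))) f

lemma shift_hom_eq_zero_of_ge {X : C} {n j : ℤ} (hX : t.ge n X) (hj : A + j < n)
    (f : G⟦-j⟧ ⟶ X) : f = 0 :=
  hom_eq_zero_of_le_of_ge t hj ((tle_shift_iff t A (-j) (A + j) (by lia) G).2 w.le) hX f

/-- `u` vanishes on the approximating object `E`, so it factors through the remainder `D`. -/
lemma exists_factor_zero {F Y : C} (hF : t.le 0 F)
    (hY : ∀ j ∈ Set.Icc (-A) A, ∀ f : G⟦-j⟧ ⟶ Y, f = 0) (u : F ⟶ Y) :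
    ∃ (D : C) (a : F ⟶ D) (b : D ⟶ Y), t.le (-1) D ∧ a ≫ b = u := by
  obtain ⟨E, D, f, g, h, hT, hE, hD⟩ := w.approx F hF
  obtain ⟨b, hb⟩ := Triangle.yoneda_exact₂ _ hT u
    (retractClosure_coprod_shifts_hom_eq_zero hY hE _)
  exact ⟨D, g, b, hD, hb.symm⟩

lemma exists_factor_pred {F Y : C} {p : ℤ} (hF : t.le p F)
    (hY : ∀ j ∈ Set.Icc (p - A) (p + A), ∀ f : G⟦-j⟧ ⟶ Y, f = 0) (u : F ⟶ Y) :
    ∃ (D : C) (a : F ⟶ D) (b : D ⟶ Y), t.le (p - 1) D ∧ a ≫ b = u := by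
  obtain ⟨D, a, b, hD, h⟩ := w.exists_factor_zero (F := F⟦p⟧) (Y := Y⟦p⟧)
    ((tle_shift_iff t p p 0 (by lia) F).2 hF) (fun j hj => by
      rw [← hom_shift_eq_zero_iff _ Y (-p) p (by lia)]
      intro f
      rw [← cancel_epi (shiftShiftIso G j (-p) (j + p) (by lia)).inv, comp_zero]
      exact hY _ ⟨by have := hj.1; lia, by have := hj.2; lia⟩ _) (u⟦p⟧')
  refine ⟨D⟦-p⟧, (shiftShiftNeg F p).inv ≫ a⟦-p⟧', b⟦-p⟧' ≫ (shiftShiftNeg Y p).hom,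
    (tle_shift_iff t (-1) (-p) (p - 1) (by lia) D).2 hD, ?_⟩
  rw [Category.assoc, ← Functor.map_comp_assoc, h]
  have := (shiftFunctorCompIsoId C p (-p) (by lia)).hom.naturality u
  exact ((shiftShiftNeg F p).inv ≫= this).trans
    ((shiftFunctorCompIsoId C p (-p) (by lia)).inv_hom_id_app_assoc F u)

lemma exists_factor {F Y : C} {p : ℤ} (n : ℕ) (hF : t.le p F)
    (hY : ∀ j ∈ Set.Icc (p - n + 1 - A) (p + A), ∀ f : G⟦-j⟧ ⟶ Y, f = 0) (u : F ⟶ Y) :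
    ∃ (D : C) (a : F ⟶ D) (b : D ⟶ Y), t.le (p - n) D ∧ a ≫ b = u := by
  induction n with
  | zero => exact ⟨F, 𝟙 F, u, by simpa using hF, Category.id_comp u⟩
  | succ n ih =>
    push_cast at hY ⊢
    have hA := w.pos
    obtain ⟨D, a, b, hD, rfl⟩ := ih fun j hj =>
      hY j ⟨by have := hj.1; lia, hj.2⟩
    obtain ⟨D', a', b', hD', rfl⟩ := w.exists_factor_pred hD (fun j hj =>
      hY j ⟨by have := hj.1; lia, by have := hj.2; lia⟩) b
    exact ⟨D', a ≫ a', b', by rwa [← sub_sub], Category.assoc _ _ _⟩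

/-- The truncation `Y^{≤ p}` is in `T^{≤ q}` if the `Hom(G, Σ^j Y)` vanish
for `q + 1 - A ≤ j ≤ p + A`. -/
lemma le_truncLE {Y : C} {p q : ℤ} (hqp : q ≤ p)
    (hY : ∀ j ∈ Set.Icc (q + 1 - A) (p + A), ∀ f : G⟦-j⟧ ⟶ Y, f = 0) :
    t.le q ((t.truncLE p).obj Y) := by
  obtain ⟨n, hn⟩ := Int.le.dest hqp
  obtain ⟨D, a, b, hD, h⟩ := w.exists_factor (Y := Y) (p := p) n
    (t.le_of_isLE _ p)
    (fun j hj => hY j ⟨by have := hj.1; lia, hj.2⟩) ((t.truncLEι p).app Y)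
  -- Since `D` also lies in T^{≤ p}, the map `D ⟶ Y` factors back through the truncation, which
  -- becomes a summand of `D`.
  have hDp : t.IsLE D p := ⟨t.le_monotone (by lia) _ hD⟩
  refine retractClosure_le_tle t le_rfl _ ⟨D, (by lia : p - n = q) ▸ hD,
    ⟨⟨a, t.liftTruncLE b p, t.to_truncLE_obj_ext ?_⟩⟩⟩
  rw [Category.assoc, t.liftTruncLE_ι, Category.id_comp]
  exact h

/-- The truncation Y^{≤ m-A} lies in arbitrarily negative aisles, so it receives no nonzero map from
any shift of `G` and is zero. -/
lemma ge_of_hom_eq_zero {Y : C} {m : ℤ} (hY : ∀ j ≤ m, ∀ f : G⟦-j⟧ ⟶ Y, f = 0) :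
    t.ge (m - A + 1) Y := by
  rw [t.ge_iff_isGE, t.isGE_iff_isZero_truncLE_obj (m - A) _ rfl]
  refine w.gen.isZero fun j => w.shift_hom_eq_zero (n := min (m - A) (j - A)) ?_ (by lia)
  exact w.le_truncLE (by lia) fun j hj => hY j (by have := hj.2; lia)

/-- Every truncation Y^{≤ p-1} with p ≥ m + A already lies in T^{≤ m+A-1}, so the triangles
truncating at m + A and at p agree. Hence Y^{≥ m+A} lies in every coaisle; as `G` is bounded above,
it is zero. -/
lemma le_of_hom_eq_zero {Y : C} {m : ℤ} (hY : ∀ j, m ≤ j → ∀ f : G⟦-j⟧ ⟶ Y, f = 0) :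
    t.le (m + A - 1) Y := by
  have hZ : ∀ p : ℤ, m + A ≤ p → t.ge p ((t.truncGE (m + A)).obj Y) := by
    intro p hp
    have h1 : t.le (m + A - 1) ((t.truncLE (p - 1)).obj Y) :=
      w.le_truncLE (by lia) fun j hj => hY j (by have := hj.1; lia)
    have h2 : t.IsLE ((t.truncLE (m + A - 1)).obj Y) (m + A - 1) := inferInstance
    have h3 : t.IsGE ((t.truncGE (m + A)).obj Y) (m + A) := inferInstance
    have h4 : t.IsGE ((t.truncGE p).obj Y) p := inferInstance
    obtain ⟨e, -⟩ := t.triangle_iso_exists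
      (t.triangleLEGE_distinguished (m + A - 1) (m + A) (by lia) Y)
      (t.triangleLEGE_distinguished (p - 1) p (by lia) Y) (Iso.refl Y) (m + A - 1) (m + A) h2 h3
      ⟨h1⟩ ⟨t.ge_antitone hp _ h4.ge⟩
    exact ((t.ge p).prop_iff_of_iso (Triangle.π₃.mapIso e)).2 h4.ge
  rw [t.le_iff_isLE, t.isLE_iff_isZero_truncGE_obj (m + A - 1) (m + A) (by lia)]
  exact w.gen.isZero fun j => w.shift_hom_eq_zero_of_ge
    (hZ (max (m + A) (A + j + 1)) (by lia)) (by lia)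

/-- The identity of `X` factors through T^{≤ p-1}, making `X` a summand of an object there. -/
lemma le_pred_of_hom_eq_zero {X : C} {p : ℤ} (hX : t.le p X)
    (h : ∀ j, p - A ≤ j → ∀ f : G⟦-j⟧ ⟶ X, f = 0) : t.le (p - 1) X := by
  obtain ⟨D, a, b, hD, hab⟩ := w.exists_factor_pred hX (fun j hj => h j hj.1) (𝟙 X)
  exact retractClosure_le_tle t le_rfl _ ⟨D, hD, ⟨⟨a, b, hab⟩⟩⟩

variable [HasCoproducts.{v} C]

/-- One inclusion is that `G` is bounded above. For the other, maps from shifts of `G` to the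
coaisle of τ_G vanish in a half-line of degrees, so this coaisle is bounded below for `t`. -/
theorem isPreferred : IsPreferred t := by
  have hG := w.gen.mapsFactorFinitely
  let tG := generatedTStructure G hG
  have hA := w.pos
  have h : t.le 0 ≤ tG.le A := fun X hX => tle_of_orthogonal tG A X fun Y hY f => by
    have hGG : tG.le 0 G := by
      rw [generatedTStructure_le_zero]
      exact .of_mem _ ⟨0, by simp, ⟨(shiftFunctorZero' C (-0 : ℤ) (by simp)).symm.app G⟩⟩
    have hY' : t.ge (A - A + 1) Y := w.ge_of_hom_eq_zero fun j hj =>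
      hom_eq_zero_of_le_of_ge tG (by lia : 0 + j < A + 1)
        ((tle_shift_iff tG 0 (-j) (0 + j) (by lia) G).2 hGG) hY
    exact hom_eq_zero_of_le_of_ge t (by lia) hX hY' f
  refine ⟨G, w.gen, A, hA, ?_, generatedAisle_le_tle t w.le⟩
  have h' := tle_le_add h (-A)
  rw [zero_add, add_neg_cancel, generatedTStructure_le_zero] at h'
  exact h'

lemma exists_le_of_hom_eq_zero {H : C} (hH : IsCompactGenerator H) :
    ∃ N : ℤ, 0 < N ∧ ∀ X : C, (∀ j, 0 ≤ j → ∀ f : H⟦-j⟧ ⟶ X, f = 0) → t.le N X := by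
  have hA := w.pos
  obtain ⟨n, hn, hG⟩ := hH.exists_retractClosure w.gen.mapsFactorFinitely
  refine ⟨n + A, by lia, fun X hX => t.le_monotone (by lia) _
    (w.le_of_hom_eq_zero (m := n) fun j hj => ?_)⟩
  rw [hom_shift_eq_zero_iff G X (-j) j (by lia)]
  refine retractClosure_coprod_shifts_hom_eq_zero (fun i hi => ?_) hG
  rw [← hom_shift_eq_zero_iff _ X (-j) j (by lia)]
  intro f
  rw [← cancel_epi (shiftShiftIso H i (-j) (i + j) (by lia)).inv, comp_zero]
  exact hX _ (by have := hi.1; lia) _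

lemma exists_hom_eq_zero {H : C} (hH : MapsFactorFinitely H) :
    ∃ N : ℤ, 0 < N ∧ ∀ X : C, t.le (-N) X → ∀ f : H ⟶ X, f = 0 := by
  have hA := w.pos
  obtain ⟨n, hn, hr⟩ := w.gen.exists_retractClosure hH
  exact ⟨n + A, by lia, fun X hX => retractClosure_coprod_shifts_hom_eq_zero
    (fun j hj => w.shift_hom_eq_zero hX (by have := hj.1; lia)) hr⟩

/-- Maps from `X` to the dual vanish when maps from `H` to `X` do, and the latter holds for all `X`
in a sufficiently negative aisle. -/
lemma plus_self_of_isBrownComenetzDual {H I : C} (hH : MapsFactorFinitely H)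
    (hI : IsBrownComenetzDual H I) : t.plus I := by
  obtain ⟨N, -, hN⟩ := w.exists_hom_eq_zero hH
  exact ⟨-N + 1, ⟨tge_of_orthogonal t _ I fun X hX =>
    (hI.hom_eq_zero_iff X).2 (hN X (by rwa [add_sub_cancel_right] at hX))⟩⟩

end WeakApproximation

end WeakApproximation

section BrownComenetz

variable {C : Type u} [Category.{v} C] [Preadditive C] [HasShift C ℤ]
  [∀ (n : ℤ), (shiftFunctor C n).Additive]

lemma IsBrownComenetzDual.hom_shift_eq_zero_iff {G I : C} (h : IsBrownComenetzDual G I) (X : C)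
    (j : ℤ) : (∀ f : X ⟶ I⟦-j⟧, f = 0) ↔ ∀ g : G⟦-j⟧ ⟶ X, g = 0 := by
  rw [← TStr.hom_shift_eq_zero_iff X I j (-j) (by lia), h.hom_eq_zero_iff,
    TStr.hom_shift_eq_zero_iff G X (-j) j (by lia)]

end BrownComenetz

/-! ### Truncated Brown–Comenetz duals -/

section Truncation

variable {C : Type u} [Category.{v} C] [Preadditive C] [HasZeroObject C] [HasShift C ℤ]
  [∀ (n : ℤ), (shiftFunctor C n).Additive] [Pretriangulated C]

/-- Only maps from objects of T^{≤ A} to the dual can be tested on its truncation. This suffices to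
lower an existing upper bound of `X` by one, as long as the bound exceeds `A`. -/
lemma WeakApproximation.le_of_hom_truncLE_eq_zero {A : ℤ} {G : C} {t : TStructure C}
    (w : WeakApproximation A G t) {I : C} (hI : IsBrownComenetzDual G I) {X : C}
    (hX : t.minus X)
    (h : ∀ j, 0 ≤ j → ∀ f : X ⟶ ((t.truncLE A).obj I)⟦-j⟧, f = 0) : t.le A X := by
  have hA := w.pos
  obtain ⟨p, hp⟩ := hX
  obtain ⟨n, hn⟩ : ∃ n : ℕ, p ≤ A + n := ⟨(p - A).toNat, by lia⟩
  have hXn : t.le (A + n) X := t.le_monotone hn _ hp.le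
  clear hn hp p
  induction n with
  | zero => simpa using hXn
  | succ n ih =>
    refine ih ?_
    -- With bound A + n + 1 the degrees needed are j ≥ n + 1. For these Σʲ`X` lies in T^{≤ A}, so
    -- its maps to `I` factor through the truncation.
    have h1 := w.le_pred_of_hom_eq_zero hXn fun j hj => by
      push_cast at hj
      rw [← hI.hom_shift_eq_zero_iff, ← TStr.hom_shift_eq_zero_iff X I j (-j) (by lia)]
      intro f
      have hXj : t.IsLE (X⟦j⟧) A := ⟨t.le_monotone (by push_cast; lia) _
        ((tle_shift_iff t (A + (n + 1 : ℕ)) j (A + (n + 1 : ℕ) - j) (by lia) X).2 hXn)⟩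
      rw [← t.liftTruncLE_ι f A, (TStr.hom_shift_eq_zero_iff X _ j (-j) (by lia)).2
        (h j (by lia)) (t.liftTruncLE f A), zero_comp]
    exact t.le_monotone (by push_cast; lia) _ h1

end Truncation

end TStr

namespace TStr

/-! ### Classes of aisles and of the subcategories P(I) -/

section Perp

variable {S : Type u} [Category.{v} S] [Preadditive S] [HasShift S ℤ]
  [∀ (n : ℤ), (shiftFunctor S n).Additive]

lemma perp_prop_iff (I X : S) :
    (perp I).prop X ↔ ∀ j : ℤ, 0 ≤ j → ∀ f : X ⟶ I⟦-j⟧, f = 0 := by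
  constructor
  · intro h j hj f
    exact h f (shifts_of_mem I hj)
  · rintro h Y f ⟨j, hj, ⟨e⟩⟩
    rw [← cancel_mono e.hom, zero_comp]
    exact h j hj _

end Perp

section Classes

variable {S : Type u} [Category.{v} S] [Preadditive S] [HasZeroObject S] [HasShift S ℤ]
  [∀ (n : ℤ), (shiftFunctor S n).Additive] [Pretriangulated S]

lemma aisleClass_le_iff (s s' : TStructure S) :
    aisleClass s ≤ aisleClass s' ↔ ∃ N : ℤ, 0 < N ∧ s.le 0 ≤ s'.le N := by
  refine (ShiftClass.mk_le_mk_iff _ _).trans (exists_congr fun N => and_congr_right fun _ => ?_)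
  change s.le 0 ≤ (s'.le 0).shift N ↔ _
  rw [s'.shift_le N 0 N (add_zero N)]

lemma aisleClass_le_of_le {s s' : TStructure S} {n m : ℤ} (h : s.le n ≤ s'.le m) :
    aisleClass s ≤ aisleClass s' := by
  refine (aisleClass_le_iff s s').2 ⟨max (m - n) 1, by simp, ?_⟩
  have := tle_le_add h (-n)
  rw [add_neg_cancel] at this
  exact this.trans (s'.le_monotone (by simp [sub_eq_add_neg]))

lemma IsUnionLE.of_aisleClass_le {s s' : TStructure S} (h : IsUnionLE s)
    (hs : aisleClass s ≤ aisleClass s') : IsUnionLE s' := by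
  intro X
  obtain ⟨N, hN, hss⟩ := (aisleClass_le_iff s s').1 hs
  obtain ⟨m, hm, hX⟩ := h X
  exact ⟨N + m, by lia, tle_le_add hss m X (by rwa [zero_add])⟩

lemma equivalent_iff_aisleClass_eq (s s' : TStructure S) :
    Equivalent s s' ↔ aisleClass s = aisleClass s' := by
  constructor
  · rintro ⟨N, -, h, h'⟩
    exact le_antisymm (aisleClass_le_of_le h) (aisleClass_le_of_le h')
  · intro h
    obtain ⟨N, hN, h1⟩ := (aisleClass_le_iff s s').1 h.le
    obtain ⟨N', hN', h2⟩ := (aisleClass_le_iff s' s).1 h.ge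
    refine ⟨max N N', by simp [hN], ?_, h2.trans (s.le_monotone (le_max_right _ _))⟩
    have := tle_le_add h1 (-N)
    rw [zero_add, add_neg_cancel] at this
    exact (s.le_monotone (by simp)).trans this

/-- If `I` is in S^{≥ m}, then S^{≤ m-1} is orthogonal to all Σ⁻ʲ`I` with j ≥ 0; the `max` only
keeps the shift positive. -/
lemma aisleClass_le_perpClass (s : TStructure S) {I : S} (hI : s.plus I) :
    aisleClass s ≤ perpClass I := by
  obtain ⟨m, hm⟩ := hI
  refine (ShiftClass.mk_le_mk_iff _ _).2 ⟨max (1 - m) 1, by simp, fun X hX => ?_⟩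
  refine (perp_prop_iff I _).2 fun j hj f => hom_eq_zero_of_le_of_ge s
    (n := -max (1 - m) 1) (m := m + j) (by have := le_max_left (1 - m) 1; lia)
    ((tle_shift_iff s 0 _ _ (by lia) X).2 hX)
    ((tge_shift_iff s m (-j) (m + j) (by lia) I).2 hm.ge) f

lemma perpClass_le_aisleClass (s : TStructure S) (I : S) {N : ℤ}
    (h : ∀ X : S, (∀ j : ℤ, 0 ≤ j → ∀ f : X ⟶ I⟦-j⟧, f = 0) → s.le N X) :
    perpClass I ≤ aisleClass s := by
  refine (ShiftClass.mk_le_mk_iff _ _).2 ⟨max N 1, by simp, fun X hX => ?_⟩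
  exact (tle_shift_iff s (max N 1) (max N 1) 0 (by lia) X).2
    (s.le_monotone (le_max_left _ _) _ (h X ((perp_prop_iff I X).1 hX)))

lemma isUniqueMinimal_iff_of_isLeast {α : Type*} [PartialOrder α] {A : Set α} {a : α}
    (h : IsLeast A a) (b : α) : IsUniqueMinimal A b ↔ b = a := by
  have ha : Minimal (· ∈ A) a := ⟨h.1, fun c hc _ => h.2 hc⟩
  constructor
  · exact fun hb => (hb.2 a ha).symm
  · rintro rfl
    exact ⟨ha, fun c hc => hc.eq_of_le h.1 (h.2 hc.1) |>.symm ▸ rfl⟩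

end Classes

/-! ### Restriction to 𝒯⁻, 𝒯⁺ and 𝒯ᵇ -/

section Restriction

variable {C : Type u} [Category.{v} C] [Preadditive C] [HasZeroObject C] [HasShift C ℤ]
  [∀ (n : ℤ), (shiftFunctor C n).Additive] [Pretriangulated C]

lemma fullSubcategory_shift_hom_eq_zero {S : ObjectProperty C} [S.IsTriangulated]
    {X Y : S.FullSubcategory} {n : ℤ} (h : ∀ f : X⟦n⟧ ⟶ Y, f = 0) (f : X.obj⟦n⟧ ⟶ Y.obj) :
    f = 0 := by
  have h1 := h (S.fullyFaithfulι.preimage ((S.ι.commShiftIso n).hom.app X ≫ f))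
  have h2 := congrArg S.ι.map h1
  rw [S.fullyFaithfulι.map_preimage, Functor.map_zero] at h2
  rw [← cancel_epi ((S.ι.commShiftIso n).hom.app X), h2, comp_zero]

lemma fullSubcategory_hom_shift_eq_zero {S : ObjectProperty C} [S.IsTriangulated]
    {X Y : S.FullSubcategory} {n : ℤ} (h : ∀ f : X ⟶ Y⟦n⟧, f = 0) (f : X.obj ⟶ Y.obj⟦n⟧) :
    f = 0 := by
  have h1 := h (S.fullyFaithfulι.preimage (f ≫ (S.ι.commShiftIso n).inv.app Y))
  have h2 := congrArg S.ι.map h1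
  rw [S.fullyFaithfulι.map_preimage, Functor.map_zero] at h2
  rw [← cancel_mono ((S.ι.commShiftIso n).inv.app Y), h2, zero_comp]

lemma perpClass_le_aisleClass_tStructure {S : ObjectProperty C} [S.IsTriangulated]
    (t : TStructure C) [S.HasInducedTStructure t] (I : S.FullSubcategory) {N : ℤ}
    (h : ∀ X : C, S X → (∀ j : ℤ, 0 ≤ j → ∀ f : X ⟶ I.obj⟦-j⟧, f = 0) → t.le N X) :
    perpClass I ≤ aisleClass (S.tStructure t) :=
  perpClass_le_aisleClass _ I fun X hX =>
    h X.obj X.property fun j hj => fullSubcategory_hom_shift_eq_zero (hX j hj)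

lemma aisleClass_tStructure_le {S : ObjectProperty C} [S.IsTriangulated]
    {t t' : TStructure C} [S.HasInducedTStructure t] [S.HasInducedTStructure t'] {N : ℤ}
    (h : t.le 0 ≤ t'.le N) : aisleClass (S.tStructure t) ≤ aisleClass (S.tStructure t') :=
  aisleClass_le_of_le (n := 0) (m := N) fun X hX => h X.obj hX

lemma minus_le_minus {t t' : TStructure C} {N : ℤ} (h : t.le 0 ≤ t'.le N) : t.minus ≤ t'.minus := by
  rintro X ⟨n, hn⟩
  exact ⟨N + n, ⟨tle_le_add h n X (by simpa using hn)⟩⟩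

lemma plus_le_plus {t t' : TStructure C} {N : ℤ} (h : t.le 0 ≤ t'.le N) : t'.plus ≤ t.plus := by
  rintro X ⟨n, hn⟩
  have h' := tge_le_of_tle_le (tle_le_add h (n - N - 1))
  refine ⟨0 + (n - N - 1) + 1, ⟨h' X ?_⟩⟩
  rw [show N + (n - N - 1) + 1 = n by ring]
  exact hn.ge

lemma isUnionLE_onMinus [IsTriangulated C] (t : TStructure C) : IsUnionLE t.onMinus := by
  rintro ⟨X, n, hn⟩
  exact ⟨max n 1, le_max_right _ _, t.le_monotone (le_max_left n 1) X hn.le⟩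

variable [HasCoproducts.{v} C]

/-- Preferred aisles contain one another up to shift, and this survives restriction, so a single `t`
tests the whole class. -/
lemma isPreferredOn_iff {S : ObjectProperty C} [S.IsTriangulated] {t : TStructure C}
    [S.HasInducedTStructure t] (ht : IsPreferred t) (s : TStructure S.FullSubcategory) :
    IsPreferredOn S s ↔ aisleClass s = aisleClass (S.tStructure t) := by
  constructor
  · rintro ⟨t', _, ht', h⟩
    obtain ⟨N, -, h1⟩ := ht.exists_le_le ht'
    obtain ⟨N', -, h2⟩ := ht'.exists_le_le ht
    exact ((equivalent_iff_aisleClass_eq _ _).1 h).trans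
      (le_antisymm (aisleClass_tStructure_le h2) (aisleClass_tStructure_le h1))
  · exact fun h => ⟨t, inferInstance, ht, (equivalent_iff_aisleClass_eq _ _).2 h⟩

lemma WeakApproximation.plus_of_isBrownComenetzDual {A : ℤ} {G₀ : C} {t₀ : TStructure C}
    (w : WeakApproximation A G₀ t₀) {t : TStructure C} (ht : IsPreferred t) {G I : C}
    (hG : IsCompactGenerator G) (hI : IsBrownComenetzDual G I) : t.plus I := by
  obtain ⟨N, -, h⟩ := ht.exists_le_le w.isPreferred
  exact plus_le_plus h I (w.plus_self_of_isBrownComenetzDual hG.mapsFactorFinitely hI)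

variable [IsTriangulated C]

lemma aisleClass_onMinus_le {t : TStructure C} (ht : IsPreferred t)
    {s : TStructure t.minus.FullSubcategory} (hs : IsUnionLE s) :
    aisleClass t.onMinus ≤ aisleClass s := by
  obtain ⟨G, hG, N, hN, h, -⟩ := id ht
  obtain ⟨n, -, hGn⟩ := ht.exists_le hG.mapsFactorFinitely
  obtain ⟨m, -, hm⟩ := hs ⟨G, n, ⟨hGn⟩⟩
  refine aisleClass_le_of_le (n := -N) (m := m) fun X hX =>
    tle_of_orthogonal s m X fun Y hY f => t.minus.ι.map_injective ?_
  rw [Functor.map_zero]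
  -- Orthogonality is propagated through coproducts in the ambient category; only the maps out of
  -- shifts of `G` are read in the subcategory.
  refine (h X.obj hX).hom_eq_zero (shifts_hom_eq_zero fun j hj g => ?_) _
  refine fullSubcategory_shift_hom_eq_zero (X := ⟨G, n, ⟨hGn⟩⟩) (Y := Y) (fun g => ?_) g
  exact hom_eq_zero_of_le_of_ge s (n := m + j) (by simp only [Set.mem_Iic] at hj; lia)
    ((tle_shift_iff s m (-j) (m + j) (by lia) _).2 hm) hY g

theorem isLeast_aisleClass_onMinus {t : TStructure C} (ht : IsPreferred t) :
    IsLeast {c | ∃ s : TStructure t.minus.FullSubcategory, IsUnionLE s ∧ aisleClass s = c}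
      (aisleClass t.onMinus) := by
  refine ⟨⟨_, isUnionLE_onMinus t, rfl⟩, ?_⟩
  rintro _ ⟨s, hs, rfl⟩
  exact aisleClass_onMinus_le ht hs

/-- The union condition depends only on the class of the aisle, so equality with the least class
already implies it. -/
theorem isPreferredOn_minus_iff {t : TStructure C} (ht : IsPreferred t)
    (s : TStructure t.minus.FullSubcategory) :
    IsPreferredOn t.minus s ↔ IsUnionLE s ∧
      IsUniqueMinimal {c | ∃ s' : TStructure t.minus.FullSubcategory,
        IsUnionLE s' ∧ aisleClass s' = c} (aisleClass s) := by
  rw [isPreferredOn_iff ht, isUniqueMinimal_iff_of_isLeast (isLeast_aisleClass_onMinus ht)]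
  exact ⟨fun h => ⟨(isUnionLE_onMinus t).of_aisleClass_le h.ge, h⟩, And.right⟩

namespace WeakApproximation

variable {A : ℤ} {G₀ : C} {t₀ : TStructure C} (w : WeakApproximation A G₀ t₀)

include w

/-- Duality turns P(I) into the vanishing of Hom(G, ΣʲX) for j ≥ 0, which bounds `X` above
uniformly; the reverse comparison is orthogonality. -/
theorem perpClass_eq_of_isBrownComenetzDual {t : TStructure C} (ht : IsPreferred t) {G I : C}
    (hG : IsCompactGenerator G) (hI : IsBrownComenetzDual G I) (hI' : t.plus I) :
    perpClass (⟨I, hI'⟩ : t.plus.FullSubcategory) = aisleClass t.onPlus := by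
  refine le_antisymm ?_ (aisleClass_le_perpClass _ (hI'.imp fun n hn => ⟨hn.ge⟩))
  obtain ⟨N, -, h⟩ := w.isPreferred.exists_le_le ht
  obtain ⟨M, -, h'⟩ := w.exists_le_of_hom_eq_zero hG
  refine perpClass_le_aisleClass_tStructure t _ (N := N + M) fun X _ hX => ?_
  refine tle_le_add h M X ?_
  rw [zero_add]
  exact h' X fun j hj => (hI.hom_shift_eq_zero_iff X j).1 (hX j hj)

theorem isLeast_perpClass_plus {t : TStructure C} (ht : IsPreferred t) :
    IsLeast (Set.range perpClass) (aisleClass t.onPlus) := by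
  obtain ⟨I, hI⟩ := exists_isBrownComenetzDual w.gen
  refine ⟨⟨_, w.perpClass_eq_of_isBrownComenetzDual ht w.gen hI
    (w.plus_of_isBrownComenetzDual ht w.gen hI)⟩, ?_⟩
  rintro _ ⟨J, rfl⟩
  exact aisleClass_le_perpClass _ (J.property.imp fun n hn => ⟨hn.ge⟩)

theorem isLeast_perpClass_bounded {t : TStructure C} (ht : IsPreferred t) :
    IsLeast (Set.range perpClass) (aisleClass t.onBounded) := by
  have hle : ∀ J : t.bounded.FullSubcategory, aisleClass t.onBounded ≤ perpClass J :=
    fun J => aisleClass_le_perpClass _ (J.property.1.imp fun n hn => ⟨hn.ge⟩)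
  refine ⟨?_, by rintro _ ⟨J, rfl⟩; exact hle J⟩
  obtain ⟨I, hI⟩ := exists_isBrownComenetzDual w.gen
  obtain ⟨N, -, h⟩ := w.isPreferred.exists_le_le ht
  obtain ⟨N', -, h'⟩ := ht.exists_le_le w.isPreferred
  obtain ⟨m, hm⟩ := w.plus_self_of_isBrownComenetzDual w.gen.mapsFactorFinitely hI
  -- The dual is bounded below, and truncating at `A` bounds it above while keeping enough of it to
  -- detect the aisle.
  have hJ : t.bounded ((t₀.truncLE A).obj I) :=
    ⟨plus_le_plus h' _ ⟨m, inferInstance⟩, minus_le_minus h _ ⟨A, inferInstance⟩⟩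
  refine ⟨⟨_, hJ⟩, le_antisymm ?_ (hle _)⟩
  refine perpClass_le_aisleClass_tStructure t _ (N := N + A) fun X hX hX' => ?_
  refine tle_le_add h A X ?_
  rw [zero_add]
  exact w.le_of_hom_truncLE_eq_zero hI (minus_le_minus h' X hX.2) hX'

end WeakApproximation

end Restriction

end TStr

theorem mainTheorem9 (C : Type u) [Category.{v} C] [Preadditive C] [HasZeroObject C]
    [HasShift C ℤ] [∀ (n : ℤ), (shiftFunctor C n).Additive] [Pretriangulated C]
    [IsTriangulated C] [HasCoproducts.{v} C] :
    ((∃ G : C, IsCompactGenerator G) →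
      (∃ t : TStructure C, IsPreferred t) ∧
      ∀ t : TStructure C, IsPreferred t →
        (∃ c, IsLeast {c | ∃ s : TStructure t.minus.FullSubcategory,
          IsUnionLE s ∧ aisleClass s = c} c) ∧
        ∀ s : TStructure t.minus.FullSubcategory,
          IsPreferredOn t.minus s ↔
            IsUnionLE s ∧
            IsUniqueMinimal {c | ∃ s' : TStructure t.minus.FullSubcategory,
              IsUnionLE s' ∧ aisleClass s' = c} (aisleClass s)) ∧
    (IsWeaklyApproximable C →
      ∀ t : TStructure C, IsPreferred t →
        (∃ c : ShiftClass t.plus.FullSubcategory,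
          IsUniqueMinimal (Set.range perpClass) c ∧ IsLeast (Set.range perpClass) c ∧
          (∀ s : TStructure t.plus.FullSubcategory,
            IsPreferredOn t.plus s ↔ aisleClass s = c) ∧
          ∀ G : C, IsCompactGenerator G →
            (∃ I : C, IsBrownComenetzDual G I) ∧
            ∀ I : C, IsBrownComenetzDual G I →
              ∃ hI : t.plus I, perpClass (⟨I, hI⟩ : t.plus.FullSubcategory) = c) ∧
        ∃ c : ShiftClass t.bounded.FullSubcategory,
          IsUniqueMinimal (Set.range perpClass) c ∧ IsLeast (Set.range perpClass) c ∧
          ∀ s : TStructure t.bounded.FullSubcategory,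
            IsPreferredOn t.bounded s ↔ aisleClass s = c) := by
  refine ⟨fun ⟨G, hG⟩ => ⟨⟨_, isPreferred_generatedTStructure hG⟩, fun t ht =>
    ⟨⟨_, isLeast_aisleClass_onMinus ht⟩, isPreferredOn_minus_iff ht⟩⟩, fun hC t ht => ?_⟩
  obtain ⟨A, G₀, t₀, w⟩ := hC.exists_weakApproximation
  have hplus := w.isLeast_perpClass_plus ht
  have hbounded := w.isLeast_perpClass_bounded ht
  refine ⟨⟨_, (isUniqueMinimal_iff_of_isLeast hplus _).2 rfl, hplus, isPreferredOn_iff ht,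
    fun G hG => ⟨exists_isBrownComenetzDual hG, fun I hI => ?_⟩⟩,
    ⟨_, (isUniqueMinimal_iff_of_isLeast hbounded _).2 rfl, hbounded, isPreferredOn_iff ht⟩⟩
  have hI' := w.plus_of_isBrownComenetzDual ht hG hI
  exact ⟨hI', w.perpClass_eq_of_isBrownComenetzDual ht hG hI hI'⟩
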